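/- Let $\mathbb{K}\in\{\mathbb{R},\mathbb{C}\}$, let $A$ be a (not necessarily unital) Banach algebra over $\mathbb{K}$, let $G$ be a locally compact Hausdorff group with a fixed left Haar measure $dr$ and modular function $\Delta$ (normalized by $\int_G f(r)\,dr=\int_G f(r^{-1})\Delta(r^{-1})\,dr$), and let $\alpha:G\to\mathrm{Aut}(A)$ be a strongly continuous representation with $\sup_{s}\|\alpha_s\|<\infty$. Assume that $A$ has a bounded two-sided approximate identity. Let $\omega$ be a weight on $G$, i.e. a non-zero, submultiplicative, Borel measurable function $\omega:G\to[0,\infty)$, and let $L^1(G,A,\omega;\alpha)$ be the completion of $C_c(G,A)$ for the norm $\|f\|_{1,\omega}=\int_G\|f(r)\|\omega(r)\,dr$, with the continuous multiplication extending $[f*g](s)=\int_G f(r)\alpha_r(g(r^{-1}s))\,dr$. Let $X$ be a Banach space over $\mathbb{K}$. A bounded linear map into $B(X)$ is called non-degenerate if the span of the ranges of its values is dense in $X$. Consider, on the one hand, the pairs $(\pi,U)$ such that $\pi:A\to B(X)$ is a non-degenerate bounded anti-representation, $U:G\to B(X)$ is a strongly continuous anti-representation, $U_r\pi(a)U_r^{-1}=\pi(\alpha_{r^{-1}}(a))$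 for all $a\in A$, $r\in G$, and $\|U_r\|\le C_U\,\omega(r)$ for some constant $C_U$ and all $r\in G$; and, on the other hand, the non-degenerate bounded anti-representations $T$ of $L^1(G,A,\omega;\alpha)$ on $X$. Then the following two maps are well defined and mutually inverse bijections between these two classes. (i) $(\pi,U)\mapsto T^{(\pi,U)}$, where $T^{(\pi,U)}$ is determined by $T^{(\pi,U)}(f)x=\int_G U_r\pi(f(r))x\,dr$ for $f\in C_c(G,A)$, $x\in X$. (ii) $T\mapsto(\pi^T,U^T)$, where $$\pi^T(a)=\text{SOT-}\lim_{(V,i)}T\big((z_V\otimes u_ia)^\vee\big)\quad(a\in A),\qquad U^T_s=\text{SOT-}\lim_{(V,i)}T\big((z_V(\cdot\, s^{-1})\otimes u_i)^\vee\big)\quad(s\in G).$$ Here $f^\vee(r)=\Delta(r^{-1})\alpha_r(f(r))$ for $f\in C_c(G,A)$; $(z\otimes a)(r)=z(r)a$; $\mathcal{Z}$ is any neighbourhood base of $e\in G$ all of whose elements are contained in one fixed compact set, directed by reverse inclusion; for $V\in\mathcal{Z}$, $z_V\in C_c(G)$ is any function with $z_V\ge0$, supported in $V$, with $\int_G z_V(r^{-1})\,dr=1$;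 and $(u_i)$ is any bounded approximate right identity of $A$ (a net with $au_i\to a$ for all $a\in A$). Furthermore: 1. $\|T^{(\pi,U)}\|\le C_U\|\pi\|$ for every constant $C_U$ such that $\|U_r\|\le C_U\,\omega(r)$ for all $r\in G$; 2. $\|\pi^T\|\le\big(\inf_{V\in\mathcal{Z}}\sup_{r\in V}\omega(r)\big)\|T\|$; 3. if $A$ has an approximate right identity bounded by $M$, then $\|U^T_s\|\le M\big(\inf_{V\in\mathcal{Z}}\sup_{r\in V}\omega(r)\big)\|T\|\,\omega(s)$ for all $s\in G$. -/

import Mathlib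

open MeasureTheory Filter Topology CompactlySupported
open scoped Pointwise


noncomputable section

namespace BeurlingAnti

/-- A Banach algebra dynamical system `(A, G, α)` with `α` uniformly bounded: a strongly continuous
representation of `G` on `A` by bounded algebra homomorphisms (each of which is then an
automorphism, with inverse `α s⁻¹`), such that `‖α s‖ ≤ C` for some `C` and all `s`. -/
structure BddDynSystem (𝕜 G A : Type*) [RCLike 𝕜] [Group G] [TopologicalSpace G]
    [NonUnitalNormedRing A] [NormedSpace 𝕜 A] where
  /-- the representation of `G` on the Banach space `A` -/
  toHom : G →* (A →L[𝕜] A)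
  map_mul' : ∀ s a b, toHom s (a * b) = toHom s a * toHom s b
  strong_cont' : ∀ a, Continuous fun s => toHom s a
  bdd' : ∃ C : ℝ, ∀ s, ‖toHom s‖ ≤ C

instance (𝕜 G A : Type*) [RCLike 𝕜] [Group G] [TopologicalSpace G]
    [NonUnitalNormedRing A] [NormedSpace 𝕜 A] :
    CoeFun (BddDynSystem 𝕜 G A) (fun _ => G → (A →L[𝕜] A)) := ⟨fun α => α.toHom⟩

/-- A weight on `G`: a non-zero, submultiplicative, Borel measurable function `G → [0, ∞)`. -/
structure Weight (G : Type*) [Group G] [MeasurableSpace G] where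
  /-- the underlying function -/
  toFun : G → ℝ
  nonneg' : ∀ s, 0 ≤ toFun s
  submul' : ∀ s t, toFun (s * t) ≤ toFun s * toFun t
  measurable' : Measurable toFun
  ne_zero' : ∃ s, toFun s ≠ 0

instance (G : Type*) [Group G] [MeasurableSpace G] : CoeFun (Weight G) (fun _ => G → ℝ) :=
  ⟨fun ω => ω.toFun⟩

/-- The modular function `Δ` of `G`, normalized by `Δ(s) ∫ f(rs) dr = ∫ f(r) dr` for left Haar
measure, equivalently by `∫ f(r) dr = ∫ f(r⁻¹) Δ(r⁻¹) dr`. (Mathlib's `modularCharacterFun` is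
the reciprocal of this function.) -/
def modulus {G : Type*} [Group G] [TopologicalSpace G] [IsTopologicalGroup G]
    [LocallyCompactSpace G] (s : G) : ℝ :=
  (Measure.modularCharacterFun s⁻¹ : ℝ)

section Group

variable {G : Type*} [Group G] [TopologicalSpace G] [IsTopologicalGroup G]
  [LocallyCompactSpace G] [MeasurableSpace G] [BorelSpace G]

theorem modulus_mul_integral (μ : Measure G) [μ.IsHaarMeasure] (f : G → ℝ) (hf : Continuous f)
    (hc : HasCompactSupport f) (s : G) : modulus s * ∫ r, f (r * s) ∂μ = ∫ r, f r ∂μ := by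
  have key : ∀ (g : G → ℝ), Continuous g → HasCompactSupport g → ∀ t : G,
      ∫ r, g (r * t) ∂μ = (Measure.modularCharacterFun t : ℝ) * ∫ r, g r ∂μ := by
    intro g hg hgc t
    rw [Measure.modularCharacterFun_eq_haarScalarFactor μ t]
    have h := Measure.integral_isMulLeftInvariant_eq_smul_of_hasCompactSupport
      (Measure.map (· * t) μ) μ hg hgc
    rw [integral_map (measurable_mul_const t).aemeasurable hg.aestronglyMeasurable] at h
    rw [h, integral_smul_nnreal_measure]
    rfl
  have h := key (fun r => f (r * s)) (hf.comp (continuous_mul_const s))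
    (hc.comp_homeomorph (Homeomorph.mulRight s)) s⁻¹
  simp only [inv_mul_cancel_right] at h
  exact h.symm

theorem continuous_modulus : Continuous (modulus : G → ℝ) := by
  obtain ⟨⟨f, f_cont⟩, f_comp, f_nonneg, f_one⟩ :
    ∃ f : C(G, ℝ), HasCompactSupport f ∧ 0 ≤ f ∧ f 1 ≠ 0 := exists_continuous_nonneg_pos 1
  let μ : Measure G := Measure.haar
  have hpos : 0 < ∫ r, f r ∂μ :=
    f_cont.integral_pos_of_hasCompactSupport_nonneg_nonzero f_comp f_nonneg f_one
  have hc : Continuous fun s : G => ∫ r, f (r * s) ∂μ := by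
    rw [continuous_iff_continuousAt]
    intro s
    obtain ⟨N, hN, hsN⟩ := exists_compact_mem_nhds s
    have hk : IsCompact (tsupport f * N⁻¹) := f_comp.isCompact.mul hN.inv
    have : ContinuousOn (fun s : G => ∫ r, f (r * s) ∂μ) N := by
      refine continuousOn_integral_of_compact_support hk ?_ ?_
      · exact (f_cont.comp (continuous_snd.mul continuous_fst)).continuousOn
      · intro p r hp hr
        by_contra h
        exact hr ⟨r * p, subset_tsupport _ h, p⁻¹, by simpa using hp, by simp⟩
    exact this.continuousAt hsN
  have hne : ∀ s : G, ∫ r, f (r * s) ∂μ ≠ 0 := by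
    intro s h
    have := modulus_mul_integral μ f f_cont f_comp s
    rw [h, mul_zero] at this
    exact hpos.ne this
  have : (modulus : G → ℝ) = fun s => (∫ r, f r ∂μ) / ∫ r, f (r * s) ∂μ := by
    funext s
    rw [eq_div_iff (hne s)]
    exact modulus_mul_integral μ f f_cont f_comp s
  rw [this]
  exact continuous_const.div hc hne

/-- A weight is bounded on compact sets. -/
theorem Weight.bddOn_compact (ω : Weight G) {K : Set G} (hK : IsCompact K) :
    ∃ C : ℝ, ∀ s ∈ K, ω s ≤ C := by
  let μ : Measure G := Measure.haar
  obtain ⟨N, hN, h1N⟩ := exists_compact_mem_nhds (1 : G)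
  let E : ℕ → Set G := fun n => {s | ω s ≤ n ∧ ω s⁻¹ ≤ n}
  have hE : ∀ n, MeasurableSet (E n) := fun n =>
    (measurableSet_le ω.measurable' measurable_const).inter
      (measurableSet_le (ω.measurable'.comp measurable_inv) measurable_const)
  have hcov : interior N ⊆ ⋃ n, (E n ∩ interior N) := by
    intro s hs
    obtain ⟨n, hn⟩ := exists_nat_ge (max (ω s) (ω s⁻¹))
    exact Set.mem_iUnion.2 ⟨n, ⟨le_trans (le_max_left _ _) hn, le_trans (le_max_right _ _) hn⟩, hs⟩
  have hposN : μ (interior N) ≠ 0 :=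
    (isOpen_interior.measure_pos μ ⟨1, mem_interior_iff_mem_nhds.2 h1N⟩).ne'
  obtain ⟨n, hn⟩ : ∃ n, μ (E n ∩ interior N) ≠ 0 := by
    by_contra! h
    exact hposN (measure_mono_null hcov (measure_iUnion_null h))
  have hfin : μ (E n ∩ interior N) ≠ ⊤ :=
    ((measure_mono (Set.inter_subset_right.trans interior_subset)).trans_lt
      hN.measure_lt_top).ne
  have hnb := Measure.div_mem_nhds_one_of_haar_pos_ne_top μ (E n ∩ interior N)
    ((hE n).inter isOpen_interior.measurableSet) (pos_iff_ne_zero.2 hn) hfin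
  have hbd : ∀ s ∈ (E n ∩ interior N) / (E n ∩ interior N), ω s ≤ n * n := by
    rintro _ ⟨a, ha, b, hb, rfl⟩
    change ω (a / b) ≤ _
    rw [div_eq_mul_inv]
    exact (ω.submul' _ _).trans
      (mul_le_mul ha.1.1 hb.1.2 (ω.nonneg' _) (Nat.cast_nonneg n))
  refine hK.induction_on (p := fun S => ∃ C : ℝ, ∀ s ∈ S, ω s ≤ C) ⟨0, by simp⟩
    ?_ ?_ ?_
  · rintro S T hST ⟨C, hC⟩
    exact ⟨C, fun s hs => hC s (hST hs)⟩
  · rintro S T ⟨C, hC⟩ ⟨D, hD⟩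
    refine ⟨max C D, ?_⟩
    rintro s (hs | hs)
    · exact (hC s hs).trans (le_max_left _ _)
    · exact (hD s hs).trans (le_max_right _ _)
  · intro x _
    refine ⟨_, mem_nhdsWithin_of_mem_nhds
      ((continuous_const_mul x⁻¹).continuousAt.preimage_mem_nhds (by simpa using hnb)),
      ω x * (n * n), ?_⟩
    intro s hs
    have := ω.submul' x (x⁻¹ * s)
    rw [mul_inv_cancel_left] at this
    exact this.trans (mul_le_mul_of_nonneg_left (hbd _ hs) (ω.nonneg' _))

end Group

section Spaces

variable {𝕜 G A : Type*} [RCLike 𝕜] [Group G] [TopologicalSpace G]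
  [NonUnitalNormedRing A] [NormedSpace 𝕜 A]

theorem BddDynSystem.continuous_uncurry (α : BddDynSystem 𝕜 G A) :
    Continuous fun p : G × A => α p.1 p.2 := by
  obtain ⟨C, hC⟩ := α.bdd'
  rw [continuous_iff_continuousAt]
  rintro ⟨r, a⟩
  have h1 : Tendsto (fun p : G × A => α p.1 (p.2 - a)) (𝓝 (r, a)) (𝓝 0) := by
    refine squeeze_zero_norm (a := fun p : G × A => C * ‖p.2 - a‖)
      (fun p => (α p.1).le_of_opNorm_le (hC p.1) _) ?_
    have : Continuous fun p : G × A => C * ‖p.2 - a‖ := by fun_prop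
    simpa using this.tendsto (r, a)
  have h2 : Tendsto (fun p : G × A => α p.1 a) (𝓝 (r, a)) (𝓝 (α r a)) :=
    ((α.strong_cont' a).comp continuous_fst).tendsto (r, a)
  have := h1.add h2
  simpa [ContinuousAt] using this

theorem conv_support (α : BddDynSystem 𝕜 G A) (f g : G → A) (s r : G) (h : f r * α r (g (r⁻¹ * s)) ≠ 0) :
    r ∈ Function.support f ∧ r⁻¹ * s ∈ Function.support g := by
  constructor
  · intro h0; exact h (by simp [h0])
  · intro h0; exact h (by simp [h0])

theorem conv_continuous_uncurry [IsTopologicalGroup G] (α : BddDynSystem 𝕜 G A) (f g : C_c(G, A)) :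
    Continuous fun p : G × G => f p.2 * α p.2 (g (p.2⁻¹ * p.1)) := by
  refine (f.continuous.comp continuous_snd).mul ?_
  exact α.continuous_uncurry.comp (continuous_snd.prodMk
    (g.continuous.comp (continuous_snd.inv.mul continuous_fst)))

variable [MeasurableSpace G]

/-- The space `C_c(G, A)`, to be endowed with the weighted norm `‖·‖_{1,ω}`. (The system `α` is
recorded in the type because it determines the multiplication.) -/
@[nolint unusedArguments]
def WCc (_μ : Measure G) (_α : BddDynSystem 𝕜 G A) (_ω : Weight G) : Type _ := C_c(G, A)

variable (μ : Measure G) (α : BddDynSystem 𝕜 G A) (ω : Weight G)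

instance : AddCommGroup (WCc μ α ω) := inferInstanceAs (AddCommGroup C_c(G, A))
instance : Module 𝕜 (WCc μ α ω) := inferInstanceAs (Module 𝕜 C_c(G, A))
instance : FunLike (WCc μ α ω) G A := inferInstanceAs (FunLike C_c(G, A) G A)

/-- The function `f ∈ C_c(G, A)` as an element of the weighted space. -/
def toWCc (f : C_c(G, A)) : WCc μ α ω := f

variable {μ α ω} in
theorem WCc.continuous (f : WCc μ α ω) : Continuous f :=
  map_continuous (F := C_c(G, A)) f

variable {μ α ω} in
theorem WCc.hasCompactSupport (f : WCc μ α ω) : HasCompactSupport f :=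
  CompactlySupportedContinuousMap.hasCompactSupport' (α := G) (β := A) f

variable [IsTopologicalGroup G] [BorelSpace G] [μ.IsHaarMeasure]

theorem conv_integrable (f g : C_c(G, A)) (s : G) :
    Integrable (fun r => f r * α r (g (r⁻¹ * s))) μ := by
  refine Continuous.integrable_of_hasCompactSupport ?_ ?_
  · exact (conv_continuous_uncurry α f g).comp (Continuous.prodMk_right s)
  · refine f.hasCompactSupport.mono fun r hr => (conv_support α f g s r hr).1

section

variable [NormedSpace ℝ A]

/-- The twisted convolution `[f * g](s) = ∫ f(r) α_r(g(r⁻¹ s)) dr` on `C_c(G, A)`. -/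
def conv (f g : C_c(G, A)) : C_c(G, A) where
  toFun s := ∫ r, f r * α r (g (r⁻¹ * s)) ∂μ
  continuous_toFun := by
    rw [← continuousOn_univ]
    refine continuousOn_integral_of_compact_support f.hasCompactSupport
      (conv_continuous_uncurry α f g).continuousOn ?_
    intro s r _ hr
    simp [image_eq_zero_of_notMem_tsupport hr]
  hasCompactSupport' := by
    refine HasCompactSupport.intro'
      (f.hasCompactSupport.isCompact.mul g.hasCompactSupport.isCompact)
      ((isClosed_tsupport _).mul_left_of_isCompact f.hasCompactSupport) ?_
    intro s hs
    refine integral_eq_zero_of_ae (Eventually.of_forall fun r => ?_)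
    by_contra h
    obtain ⟨h1, h2⟩ := conv_support α f g s r h
    exact hs ⟨r, subset_tsupport _ h1, r⁻¹ * s, subset_tsupport _ h2, by simp⟩

theorem conv_apply (f g : C_c(G, A)) (s : G) :
    conv μ α f g s = ∫ r, f r * α r (g (r⁻¹ * s)) ∂μ := rfl

end

variable [LocallyCompactSpace G]

theorem integrable_mul_weight (h : G → ℝ) (hc : Continuous h) (hs : HasCompactSupport h) :
    Integrable (fun r => h r * ω r) μ := by
  obtain ⟨C, hC⟩ := ω.bddOn_compact hs.isCompact
  obtain ⟨D, hD⟩ := hs.exists_bound_of_continuous hc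
  rw [← integrableOn_iff_integrable_of_support_subset (s := tsupport h)
    (fun r hr => subset_tsupport _ fun h0 => hr (by simp [h0]))]
  refine Measure.integrableOn_of_bounded (M := D * C) hs.isCompact.measure_ne_top
    (hc.measurable.mul ω.measurable').aestronglyMeasurable ?_
  filter_upwards [ae_restrict_mem (isClosed_tsupport h).measurableSet] with r hr
  rw [norm_mul, Real.norm_of_nonneg (ω.nonneg' r)]
  exact mul_le_mul (hD r) (hC r hr) (ω.nonneg' r) ((norm_nonneg _).trans (hD r))

variable {μ α ω} in
theorem WCc.integrable (f : WCc μ α ω) : Integrable (fun r => ‖f r‖ * ω r) μ :=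
  integrable_mul_weight _ _ _ (f.continuous).norm (f.hasCompactSupport).norm

/-- The weighted norm `‖f‖_{1,ω} = ∫ ‖f(r)‖ ω(r) dr` on `C_c(G, A)`. -/
def WCc.seminorm : AddGroupSeminorm (WCc μ α ω) where
  toFun f := ∫ r, ‖f r‖ * ω r ∂μ
  map_zero' := by
    have : ∀ r, (0 : WCc μ α ω) r = 0 := fun r => rfl
    simp [this]
  add_le' f g := by
    rw [← integral_add f.integrable g.integrable]
    refine integral_mono (f + g).integrable (f.integrable.add g.integrable) fun r => ?_
    change ‖f r + g r‖ * ω r ≤ ‖f r‖ * ω r + ‖g r‖ * ω r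
    rw [← add_mul]
    exact mul_le_mul_of_nonneg_right (norm_add_le _ _) (ω.nonneg' r)
  neg' f := by
    have : ∀ r, (-f) r = -(f r) := fun r => rfl
    simp [this]

instance : SeminormedAddCommGroup (WCc μ α ω) :=
  (WCc.seminorm μ α ω).toSeminormedAddCommGroup

theorem WCc.norm_def (f : WCc μ α ω) : ‖f‖ = ∫ r, ‖f r‖ * ω r ∂μ := rfl

instance : NormedSpace 𝕜 (WCc μ α ω) where
  norm_smul_le c f := by
    have : ∀ r, (c • f) r = c • f r := fun r => rfl
    simp only [WCc.norm_def, this, norm_smul, mul_assoc, integral_const_mul]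
    exact le_rfl

section Conv

variable [NormedSpace ℝ A]

theorem conv_norm_le (f g : C_c(G, A)) {C : ℝ} (hC : ∀ s, ‖α s‖ ≤ C) :
    ∫ s, ‖conv μ α f g s‖ * ω s ∂μ ≤
      C * (∫ r, ‖f r‖ * ω r ∂μ) * ∫ r, ‖g r‖ * ω r ∂μ := by
  have hC0 : 0 ≤ C := (norm_nonneg _).trans (hC 1)
  let ν : Measure G := μ.withDensity fun s => ENNReal.ofReal (ω s)
  have hωm : Measurable fun s => ENNReal.ofReal (ω s) := ω.measurable'.ennreal_ofReal
  have hν : ∀ h : G → ℝ, ∫ s, h s ∂ν = ∫ s, h s * ω s ∂μ := by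
    intro h
    rw [integral_withDensity_eq_integral_toReal_smul hωm (by simp)]
    simp only [ENNReal.toReal_ofReal (ω.nonneg' _), smul_eq_mul, mul_comm]
  have hνfin : IsFiniteMeasureOnCompacts ν := by
    refine ⟨fun K hK => ?_⟩
    obtain ⟨D, hD⟩ := ω.bddOn_compact hK
    have hcl : MeasurableSet (closure K) := isClosed_closure.measurableSet
    obtain ⟨D, hD⟩ := ω.bddOn_compact hK.closure
    refine (measure_mono subset_closure).trans_lt ?_
    rw [withDensity_apply _ hcl]
    calc ∫⁻ s in closure K, ENNReal.ofReal (ω s) ∂μ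
        ≤ ∫⁻ s in closure K, ENNReal.ofReal D ∂μ :=
          setLIntegral_mono' hcl fun s hs => ENNReal.ofReal_le_ofReal (hD s hs)
      _ < ⊤ := by
          rw [setLIntegral_const]
          exact ENNReal.mul_lt_top ENNReal.ofReal_lt_top hK.closure.measure_lt_top
  let F : G → G → ℝ := fun s r => ‖f r‖ * ‖g (r⁻¹ * s)‖
  have hFc : Continuous F.uncurry := by
    refine ((f.continuous.comp continuous_snd).norm).mul ?_
    exact (g.continuous.comp (continuous_snd.inv.mul continuous_fst)).norm
  have hFs : HasCompactSupport F.uncurry := by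
    have hf := f.hasCompactSupport
    have hg := g.hasCompactSupport
    refine HasCompactSupport.intro'
      (K := (fun p : G × G => (p.1 * p.2, p.1)) '' (tsupport f ×ˢ tsupport g))
      ((hf.isCompact.prod hg.isCompact).image (by fun_prop)) ?_ ?_
    · have : (fun p : G × G => (p.1 * p.2, p.1)) '' (tsupport f ×ˢ tsupport g) =
          (fun p : G × G => (p.2, p.2⁻¹ * p.1)) ⁻¹' (tsupport f ×ˢ tsupport g) := by
        ext ⟨s, r⟩
        constructor
        · rintro ⟨⟨a, b⟩, h, h'⟩
          simp only [Prod.mk.injEq] at h'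
          obtain ⟨rfl, rfl⟩ := h'
          simpa using h
        · intro h
          exact ⟨(r, r⁻¹ * s), h, by simp⟩
      rw [this]
      exact ((isClosed_tsupport _).prod (isClosed_tsupport _)).preimage (by fun_prop)
    · rintro ⟨s, r⟩ h
      by_contra h0
      refine h ⟨(r, r⁻¹ * s), ⟨subset_tsupport _ fun h1 => h0 ?_,
        subset_tsupport _ fun h1 => h0 ?_⟩, by simp⟩
      · simp [F, h1]
      · simp [F, h1]
  have hFi : Integrable (fun s => ∫ r, F s r ∂μ) ν := by
    refine Continuous.integrable_of_hasCompactSupport ?_ ?_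
    · rw [← continuousOn_univ]
      refine continuousOn_integral_of_compact_support f.hasCompactSupport hFc.continuousOn ?_
      intro s r _ hr
      simp [F, image_eq_zero_of_notMem_tsupport hr]
    · refine HasCompactSupport.intro'
        (f.hasCompactSupport.isCompact.mul g.hasCompactSupport.isCompact)
        ((isClosed_tsupport _).mul_left_of_isCompact f.hasCompactSupport) ?_
      intro s hs
      refine integral_eq_zero_of_ae (Eventually.of_forall fun r => ?_)
      by_contra h
      refine hs ⟨r, subset_tsupport _ fun h1 => h ?_, r⁻¹ * s,
        subset_tsupport _ fun h1 => h ?_, by simp⟩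
      · simp [F, h1]
      · simp [F, h1]
  have hpt : ∀ s, ‖conv μ α f g s‖ ≤ C * ∫ r, F s r ∂μ := by
    intro s
    rw [conv_apply, ← integral_const_mul]
    have hFsr : Integrable (fun r => C * F s r) μ := by
      refine Integrable.const_mul ?_ _
      refine Continuous.integrable_of_hasCompactSupport
        (hFc.comp (Continuous.prodMk_right s)) ?_
      exact f.hasCompactSupport.mono fun r hr h1 => hr (by simp [F, h1])
    refine norm_integral_le_of_norm_le hFsr (Eventually.of_forall fun r => ?_)
    calc ‖f r * α r (g (r⁻¹ * s))‖ ≤ ‖f r‖ * ‖α r (g (r⁻¹ * s))‖ := norm_mul_le _ _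
      _ ≤ ‖f r‖ * (C * ‖g (r⁻¹ * s)‖) :=
          mul_le_mul_of_nonneg_left ((α r).le_of_opNorm_le (hC r) _) (norm_nonneg _)
      _ = C * F s r := by simp only [F]; ring
  have hinner : ∀ r, ∫ s, F s r ∂ν ≤ (‖f r‖ * ω r) * ∫ s, ‖g s‖ * ω s ∂μ := by
    intro r
    rw [hν, ← integral_const_mul,
      ← integral_mul_left_eq_self (fun s => F s r * ω s) r]
    have hg := integrable_mul_weight μ ω (fun s => ‖g s‖) g.continuous.norm
      g.hasCompactSupport.norm
    refine integral_mono_of_nonneg (Eventually.of_forall fun s => ?_)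
      (hg.const_mul _) (Eventually.of_forall fun s => ?_)
    · exact mul_nonneg (mul_nonneg (norm_nonneg _) (norm_nonneg _)) (ω.nonneg' _)
    · simp only [F, inv_mul_cancel_left]
      calc ‖f r‖ * ‖g s‖ * ω (r * s) ≤ ‖f r‖ * ‖g s‖ * (ω r * ω s) :=
            mul_le_mul_of_nonneg_left (ω.submul' r s) (by positivity)
        _ = ‖f r‖ * ω r * (‖g s‖ * ω s) := by ring
  have hconv := integrable_mul_weight μ ω (fun s => ‖conv μ α f g s‖)
      (conv μ α f g).continuous.norm (conv μ α f g).hasCompactSupport.norm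
  calc ∫ s, ‖conv μ α f g s‖ * ω s ∂μ = ∫ s, ‖conv μ α f g s‖ ∂ν := (hν _).symm
    _ ≤ ∫ s, C * ∫ r, F s r ∂μ ∂ν :=
        integral_mono_of_nonneg (Eventually.of_forall fun s => norm_nonneg _)
          (hFi.const_mul C) (Eventually.of_forall hpt)
    _ = C * ∫ r, ∫ s, F s r ∂ν ∂μ := by
        rw [integral_const_mul, integral_integral_swap_of_hasCompactSupport hFc hFs]
    _ ≤ C * ∫ r, (‖f r‖ * ω r) * ∫ s, ‖g s‖ * ω s ∂μ ∂μ := by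
        refine mul_le_mul_of_nonneg_left ?_ hC0
        refine integral_mono_of_nonneg (Eventually.of_forall fun r => integral_nonneg fun s => ?_)
          ?_ (Eventually.of_forall hinner)
        · exact mul_nonneg (norm_nonneg _) (norm_nonneg _)
        · exact (integrable_mul_weight μ ω (fun s => ‖f s‖) f.continuous.norm
            f.hasCompactSupport.norm).mul_const _
    _ = _ := by rw [integral_mul_const, mul_assoc]

variable [IsScalarTower 𝕜 A A] [SMulCommClass 𝕜 A A] [IsScalarTower ℝ 𝕜 A]

theorem conv_add_left (f f' g : C_c(G, A)) :
    conv μ α (f + f') g = conv μ α f g + conv μ α f' g := by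
  ext s
  simp only [conv_apply, CompactlySupportedContinuousMap.add_apply, add_mul]
  exact integral_add (conv_integrable μ α f g s) (conv_integrable μ α f' g s)

theorem conv_add_right (f g g' : C_c(G, A)) :
    conv μ α f (g + g') = conv μ α f g + conv μ α f g' := by
  ext s
  simp only [conv_apply, CompactlySupportedContinuousMap.add_apply, map_add, mul_add]
  exact integral_add (conv_integrable μ α f g s) (conv_integrable μ α f g' s)

theorem conv_smul_left (c : 𝕜) (f g : C_c(G, A)) :
    conv μ α (c • f) g = c • conv μ α f g := by
  ext s
  simp only [conv_apply, CompactlySupportedContinuousMap.smul_apply, smul_mul_assoc]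
  exact integral_smul c _

theorem conv_smul_right (c : 𝕜) (f g : C_c(G, A)) :
    conv μ α f (c • g) = c • conv μ α f g := by
  ext s
  simp only [conv_apply, CompactlySupportedContinuousMap.smul_apply, map_smul, mul_smul_comm]
  exact integral_smul c _

/-- Twisted convolution as a bounded bilinear map for the weighted norm. -/
def convL : WCc μ α ω →L[𝕜] WCc μ α ω →L[𝕜] WCc μ α ω :=
  LinearMap.mkContinuousOfExistsBound₂
    (LinearMap.mk₂ 𝕜 (fun f g : WCc μ α ω => toWCc μ α ω (conv μ α f g))
      (conv_add_left μ α) (conv_smul_left μ α) (conv_add_right μ α) (conv_smul_right μ α))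
    (by
      obtain ⟨C, hC⟩ := α.bdd'
      exact ⟨C, fun f g => conv_norm_le μ α ω f g hC⟩)

theorem convL_apply (f g : C_c(G, A)) :
    convL μ α ω (toWCc μ α ω f) (toWCc μ α ω g) = toWCc μ α ω (conv μ α f g) := rfl

end Conv

/-- The generalized Beurling algebra `L¹(G, A, ω; α)`: the completion of `C_c(G, A)` for the norm
`‖·‖_{1,ω}`, with the continuous extension of twisted convolution as multiplication. -/
abbrev GenBeurling : Type _ := UniformSpace.Completion (WCc μ α ω)

/-- The canonical map `C_c(G, A) → L¹(G, A, ω; α)`. -/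
def toL1 (f : C_c(G, A)) : GenBeurling μ α ω := ((toWCc μ α ω f : WCc μ α ω) : GenBeurling μ α ω)

section Mul

variable [NormedSpace ℝ A] [IsScalarTower 𝕜 A A] [SMulCommClass 𝕜 A A] [IsScalarTower ℝ 𝕜 A]

open UniformSpace.Completion in
instance : Mul (GenBeurling μ α ω) :=
  ⟨Function.curry <|
    (isDenseInducing_coe.prodMap isDenseInducing_coe).extend
      fun p : WCc μ α ω × WCc μ α ω => (convL μ α ω p.1 p.2 : GenBeurling μ α ω)⟩

open UniformSpace.Completion in
theorem GenBeurling.continuous_mul :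
    Continuous fun p : GenBeurling μ α ω × GenBeurling μ α ω => p.1 * p.2 := by
  let m : WCc μ α ω →+ WCc μ α ω →+ GenBeurling μ α ω :=
    { toFun := fun f => (toCompl (α := WCc μ α ω)).comp
        (convL μ α ω f : WCc μ α ω →ₗ[𝕜] WCc μ α ω).toAddMonoidHom
      map_zero' := by
        ext g
        exact congrArg toCompl (DFunLike.congr_fun (map_zero (convL μ α ω)) g)
      map_add' := fun f f' => by
        ext g
        exact (congrArg toCompl (DFunLike.congr_fun (map_add (convL μ α ω) f f') g)).trans
          (coe_add _ _) }
  have hm : Continuous fun p : WCc μ α ω × WCc μ α ω => m p.1 p.2 :=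
    (continuous_coe _).comp (convL μ α ω).continuous₂
  have di : IsDenseInducing (toCompl : WCc μ α ω → GenBeurling μ α ω) := isDenseInducing_coe
  exact (di.extend_Z_bilin di hm :)

open UniformSpace.Completion in
/-- The multiplication of `L¹(G, A, ω; α)` extends twisted convolution on `C_c(G, A)`. -/
theorem GenBeurling.toL1_mul (f g : C_c(G, A)) :
    toL1 μ α ω f * toL1 μ α ω g = toL1 μ α ω (conv μ α f g) :=
  (isDenseInducing_coe.prodMap isDenseInducing_coe).extend_eq
    ((continuous_coe _).comp (convL μ α ω).continuous₂)
    (toWCc μ α ω f, toWCc μ α ω g)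

end Mul

end Spaces

section Reconstruction

variable {G A : Type*} [Group G] [TopologicalSpace G] [IsTopologicalGroup G]
  [NonUnitalNormedRing A] [NormedSpace ℝ A]

/-- The function `z ⊗ a : r ↦ z(r) a`. -/
def tensor (z : C_c(G, ℝ)) (a : A) : C_c(G, A) where
  toFun r := z r • a
  continuous_toFun := z.continuous.smul continuous_const
  hasCompactSupport' := z.hasCompactSupport.smul_right

/-- The function `z(· s⁻¹) : r ↦ z(r s⁻¹)`. -/
def transR (z : C_c(G, ℝ)) (s : G) : C_c(G, ℝ) where
  toFun r := z (r * s⁻¹)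
  continuous_toFun := z.continuous.comp (continuous_mul_const s⁻¹)
  hasCompactSupport' := z.hasCompactSupport.comp_homeomorph (Homeomorph.mulRight s⁻¹)

/-- The function `f^∨ : r ↦ Δ(r⁻¹) α_r(f(r))`. -/
def check {𝕜 : Type*} [RCLike 𝕜] [LocallyCompactSpace G] [NormedSpace 𝕜 A]
    (α : BddDynSystem 𝕜 G A) (f : C_c(G, A)) : C_c(G, A) where
  toFun r := modulus r⁻¹ • α r (f r)
  continuous_toFun := by
    borelize G
    exact (continuous_modulus.comp continuous_inv).smul
      (α.continuous_uncurry.comp (continuous_id.prodMk f.continuous))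
  hasCompactSupport' := f.hasCompactSupport.mono fun r hr h0 => hr (by simp [h0])

end Reconstruction

section Objects

variable {I A : Type*} [Preorder I] [NonUnitalNormedRing A]

/-- `u` is a bounded approximate right identity of `A`: `a u_i → a` for all `a`. -/
structure IsBddApproxRightId (u : I → A) : Prop where
  tendsto : ∀ a, Tendsto (fun i => a * u i) atTop (𝓝 a)
  bdd : ∃ M : ℝ, ∀ i, ‖u i‖ ≤ M

/-- `u` is a bounded two-sided approximate identity of `A`. -/
structure IsBddApproxId (u : I → A) : Prop extends IsBddApproxRightId u where
  tendsto_left : ∀ a, Tendsto (fun i => u i * a) atTop (𝓝 a)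

/-- `𝒵` is a neighbourhood base of `e`, all of whose elements lie in one compact set. -/
structure IsCompactNhdBase {G : Type*} [Group G] [TopologicalSpace G] (𝒵 : Set (Set G)) :
    Prop where
  mem_nhds : ∀ V ∈ 𝒵, V ∈ 𝓝 (1 : G)
  base : ∀ W ∈ 𝓝 (1 : G), ∃ V ∈ 𝒵, V ⊆ W
  compact : ∃ K, IsCompact K ∧ ∀ V ∈ 𝒵, V ⊆ K

/-- A choice, for each `V ∈ 𝒵`, of a non-negative `z_V ∈ C_c(G)`, supported in `V`, with
`∫ z_V(r⁻¹) dr = 1`. -/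
structure IsBumpFamily {G : Type*} [Group G] [TopologicalSpace G] [MeasurableSpace G]
    (μ : Measure G) (𝒵 : Set (Set G)) (z : 𝒵 → C_c(G, ℝ)) : Prop where
  nonneg : ∀ V r, 0 ≤ z V r
  supp : ∀ V : 𝒵, Function.support (z V) ⊆ V
  integral_inv : ∀ V, ∫ r, z V r⁻¹ ∂μ = 1

variable {𝕜 G : Type*} [RCLike 𝕜] [Group G] [TopologicalSpace G] [MeasurableSpace G]
  [NormedSpace 𝕜 A]

/-- A linear map `π` from `B` to the bounded operators on `X` is non-degenerate if the span of
`π(B) X` is dense in `X`. -/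
def NonDegenerate {B X : Type*} [SeminormedAddCommGroup B] [NormedSpace 𝕜 B]
    [NormedAddCommGroup X] [NormedSpace 𝕜 X] (π : B →L[𝕜] (X →L[𝕜] X)) : Prop :=
  Dense (Submodule.span 𝕜 {y : X | ∃ b x, π b x = y} : Set X)

/-- The pairs `(π, U)` of type `(a, a)`: `π` is a non-degenerate bounded anti-representation of `A`
on `X`, `U` is a strongly continuous anti-representation of `G` on `X`,
`U_r π(a) U_r⁻¹ = π(α_{r⁻¹}(a))`, and `‖U_r‖ ≤ C ω(r)` for some constant `C` and all `r`. -/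
structure AAPair (α : BddDynSystem 𝕜 G A) (ω : Weight G) (X : Type*) [NormedAddCommGroup X]
    [NormedSpace 𝕜 X] where
  /-- the bounded anti-representation of `A` -/
  π : A →L[𝕜] (X →L[𝕜] X)
  /-- the strongly continuous anti-representation of `G` -/
  U : G → (X →L[𝕜] X)
  π_mul : ∀ a b, π (a * b) = π b * π a
  π_nondeg : NonDegenerate π
  U_one : U 1 = 1
  U_mul : ∀ r s, U (r * s) = U s * U r
  U_cont : ∀ x, Continuous fun r => U r x
  -- by `U_one` and `U_mul`, the inverse operator of `U r` is `U r⁻¹`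
  covariant : ∀ r a, U r * π a * U r⁻¹ = π (α r⁻¹ a)
  U_bdd : ∃ C : ℝ, ∀ r, ‖U r‖ ≤ C * ω r

/-- The non-degenerate bounded anti-representations of `L¹(G, A, ω; α)` on `X`. -/
structure AntiRep [IsTopologicalGroup G] [LocallyCompactSpace G] [BorelSpace G]
    [NormedSpace ℝ A] [IsScalarTower 𝕜 A A] [SMulCommClass 𝕜 A A] [IsScalarTower ℝ 𝕜 A]
    (μ : Measure G) [μ.IsHaarMeasure] (α : BddDynSystem 𝕜 G A) (ω : Weight G)
    (X : Type*) [NormedAddCommGroup X] [NormedSpace 𝕜 X] where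
  /-- the bounded linear map -/
  T : GenBeurling μ α ω →L[𝕜] (X →L[𝕜] X)
  T_mul : ∀ f g, T (f * g) = T g * T f
  T_nondeg : NonDegenerate T

end Objects

end BeurlingAnti

/-!
With `τ` a representation of `C_c(G, A)`, an operator `R` on `C_c(G, A)` which commutes with left
convolution, `R (f * g) = f * R g`, induces an operator on `X` by `τ(f) x ↦ τ(R f) x`; along an
approximate identity `e_i` of convolution it is the strong limit of `τ(R e_i)`. For an
anti-representation `T` of `L¹(G, A, ω; α)` we take for `R` the right multiplications
`f ↦ (r ↦ f(r) α_r(a))`, which give `π^T(a)`, and the right translations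
`f ↦ (r ↦ Δ(s⁻¹) f(r s⁻¹))`, which give `U^T_s`. The relations between `π^T` and `U^T` are those
between the operators `R`. Since `g * f` is the integral over `r` of the translates by `r` of
`t ↦ g(t) α_t(f(r))`, applying `T` to it shows that `T` is the integrated form of `(π^T, U^T)`.

Conversely, covariance turns the integrated form `T` of a pair `(π, U)` into
`T((z(· s⁻¹) ⊗ b)^∨) x = π(b) ∫ Δ(r⁻¹) z(r) U_{rs} x dr`, and since `Δ(r⁻¹) z_V(r) dr` is a
probability measure concentrating at `e`, this tends to `π(b) U_s x`. Both limit formulas, the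
injectivity of `(π, U) ↦ T` and, by taking norms, the bounds on `π` and `U` follow.
-/

namespace BeurlingAnti

section Modulus

variable {G : Type*} [Group G] [TopologicalSpace G] [IsTopologicalGroup G]
  [LocallyCompactSpace G]

theorem modulus_pos (s : G) : 0 < modulus s :=
  NNReal.coe_pos.2 (Measure.modularCharacterFun_pos _)

theorem modulus_one : modulus (1 : G) = 1 := by
  rw [modulus, inv_one, Measure.modularCharacterFun_map_one, NNReal.coe_one]

theorem modulus_mul (s t : G) : modulus (s * t) = modulus s * modulus t := by
  simp [modulus, Measure.modularCharacterFun_map_mul, mul_comm]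

theorem modulus_inv (s : G) : modulus s⁻¹ = (modulus s)⁻¹ := by
  refine eq_inv_of_mul_eq_one_left ?_
  rw [← modulus_mul, inv_mul_cancel, modulus_one]

theorem continuous_modulus_inv : Continuous fun s : G => modulus s⁻¹ := by
  borelize G
  exact continuous_modulus.comp continuous_inv

end Modulus

section Haar

variable {G E : Type*} [Group G] [TopologicalSpace G] [IsTopologicalGroup G]
  [LocallyCompactSpace G] [MeasurableSpace G] [BorelSpace G]
  [NormedAddCommGroup E] [NormedSpace ℝ E] {μ : Measure G} [μ.IsHaarMeasure]

theorem restrict_map_mul_right {K : Set G} (hK : IsCompact K) (hKc : IsClosed K) (s : G) :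
    (μ.map (· * s)).restrict K = Measure.modularCharacterFun s • μ.restrict K := by
  ext B hB
  rw [Measure.modularCharacterFun_eq_haarScalarFactor μ s, Measure.smul_apply,
    Measure.restrict_apply hB, Measure.restrict_apply hB]
  exact Measure.measure_isMulInvariant_eq_smul_of_isCompact_closure _ μ
    (hK.of_isClosed_subset isClosed_closure (closure_minimal Set.inter_subset_right hKc))

theorem modulus_smul_integral_mul_right {f : G → E} (hf : HasCompactSupport f) (s : G) :
    modulus s • ∫ r, f (r * s) ∂μ = ∫ r, f r ∂μ := by
  have integral_eq_setIntegral (ν : Measure G) : ∫ r, f r ∂ν = ∫ r in tsupport f, f r ∂ν :=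
    (setIntegral_eq_integral_of_forall_compl_eq_zero fun _ h =>
      image_eq_zero_of_notMem_tsupport h).symm
  have h_map : ∫ r, f (r * s) ∂μ = ∫ r, f r ∂μ.map (· * s) :=
    ((Homeomorph.mulRight s).measurableEmbedding.integral_map f).symm
  have h_char : modulus s * (Measure.modularCharacterFun s : ℝ) = 1 := by
    rw [modulus, ← NNReal.coe_mul, ← Measure.modularCharacterFun_map_mul, inv_mul_cancel,
      Measure.modularCharacterFun_map_one, NNReal.coe_one]
  rw [h_map, integral_eq_setIntegral, restrict_map_mul_right hf (isClosed_tsupport f),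
    integral_smul_nnreal_measure, NNReal.smul_def, smul_smul, h_char, one_smul,
    ← integral_eq_setIntegral]

theorem integral_modulus_inv_smul_mul_right {f : G → E} (hf : HasCompactSupport f) (s : G) :
    ∫ r, modulus r⁻¹ • f (r * s) ∂μ = ∫ r, modulus r⁻¹ • f r ∂μ := by
  have hΔf : HasCompactSupport fun r => modulus r⁻¹ • f r := hf.smul_left
  rw [← modulus_smul_integral_mul_right hΔf s, ← integral_smul]
  simp only [mul_inv_rev, modulus_mul, smul_smul, modulus_inv s,
    mul_inv_cancel_left₀ (modulus_pos s).ne']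

theorem integral_inv_eq_integral_modulus_inv_mul {g : G → ℝ} (hg : Continuous g)
    (hgs : HasCompactSupport g) : ∫ r, g r⁻¹ ∂μ = ∫ r, modulus r⁻¹ * g r ∂μ := by
  obtain ⟨⟨k, hk⟩, hks, hk_nonneg, hk_one⟩ :
    ∃ k : C(G, ℝ), HasCompactSupport k ∧ 0 ≤ k ∧ k 1 ≠ 0 := exists_continuous_nonneg_pos 1
  have hk_pos : 0 < ∫ r, k r ∂μ :=
    hk.integral_pos_of_hasCompactSupport_nonneg_nonzero hks hk_nonneg hk_one
  replace hks : HasCompactSupport k := hks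
  have integral_inv_measure (h : G → ℝ) : ∫ r, h r ∂μ.inv = ∫ r, h r⁻¹ ∂μ :=
    (Homeomorph.inv G).measurableEmbedding.integral_map h
  have h_density (y : G) : (∫ x, k (x * y) ∂μ)⁻¹ = modulus y * (∫ r, k r ∂μ)⁻¹ := by
    rw [← modulus_mul_integral μ k hk hks y, mul_inv, mul_inv_cancel_left₀ (modulus_pos y).ne']
  have h_combo := Measure.integral_isMulLeftInvariant_isMulRightInvariant_combo (μ := μ)
    (ν := μ.inv) (f := fun r => modulus r⁻¹ * g r) (continuous_modulus_inv.mul hg) hgs.mul_left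
    hk hks hk_nonneg hk_one
  simp only [integral_inv_measure, inv_inv, h_density] at h_combo
  rw [h_combo, ← integral_mul_const]
  refine integral_congr_ae (Eventually.of_forall fun r => ?_)
  have h_modulus := (modulus_pos r).ne'
  simp only [modulus_inv]
  field_simp

theorem integral_inv_eq_integral_modulus_inv_smul [CompleteSpace E] {g : G → E}
    (hg : Continuous g) (hgs : HasCompactSupport g) :
    ∫ r, g r⁻¹ ∂μ = ∫ r, modulus r⁻¹ • g r ∂μ := by
  refine (SeparatingDual.eq_iff_forall_dual_eq (R := ℝ)).2 fun φ => ?_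
  have h_inv : Integrable (fun r => g r⁻¹) μ :=
    (hg.comp continuous_inv).integrable_of_hasCompactSupport
      (hgs.comp_homeomorph (Homeomorph.inv G))
  have h_modulus : Integrable (fun r => modulus r⁻¹ • g r) μ :=
    (continuous_modulus_inv.smul hg).integrable_of_hasCompactSupport hgs.smul_left
  rw [← φ.integral_comp_comm h_inv, ← φ.integral_comp_comm h_modulus]
  simp only [map_smul, smul_eq_mul]
  exact integral_inv_eq_integral_modulus_inv_mul (φ.continuous.comp hg)
    (hgs.comp_left (map_zero φ))

end Haar

section Weight

variable {G : Type*} [Group G] [MeasurableSpace G]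

theorem Weight.one_le_one (ω : Weight G) : 1 ≤ ω 1 := by
  obtain ⟨s, hs⟩ := ω.ne_zero'
  have h_submul := ω.submul' s 1
  rw [mul_one] at h_submul
  exact le_of_mul_le_mul_left (by rwa [mul_one]) ((ω.nonneg' s).lt_of_ne' hs)

theorem Weight.exists_eventually_le [TopologicalSpace G] [IsTopologicalGroup G]
    [LocallyCompactSpace G] [BorelSpace G] (ω : Weight G) (s : G) :
    ∃ D, ∀ᶠ r in 𝓝 s, ω r ≤ D := by
  obtain ⟨N, hN, hsN⟩ := exists_compact_mem_nhds s
  obtain ⟨D, hD⟩ := ω.bddOn_compact hN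
  exact ⟨D, mem_of_superset hsN hD⟩

end Weight

theorem BddDynSystem.inv_apply_apply {𝕜 G A : Type*} [RCLike 𝕜] [Group G] [TopologicalSpace G]
    [NonUnitalNormedRing A] [NormedSpace 𝕜 A] (α : BddDynSystem 𝕜 G A) (s : G) (a : A) :
    α s⁻¹ (α s a) = a := by
  change (α.toHom s⁻¹ * α.toHom s) a = a
  rw [← map_mul, inv_mul_cancel, map_one]
  rfl

section StrongLimits

variable {𝕜 X I : Type*} [RCLike 𝕜] [NormedAddCommGroup X] [NormedSpace 𝕜 X] {l : Filter I}
  {S : I → X →L[𝕜] X} {C : ℝ} {D : Set X}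

theorem tendsto_apply_of_tendsto (hS : ∀ᶠ i in l, ‖S i‖ ≤ C) {y : I → X} {x w : X}
    (hy : Tendsto y l (𝓝 x)) (hx : Tendsto (fun i => S i x) l (𝓝 w)) :
    Tendsto (fun i => S i (y i)) l (𝓝 w) := by
  have h_diff : Tendsto (fun i => S i (y i - x)) l (𝓝 0) := by
    refine squeeze_zero_norm' (a := fun i => C * ‖y i - x‖)
      (hS.mono fun i hi => (S i).le_of_opNorm_le hi _) ?_
    simpa using (tendsto_iff_norm_sub_tendsto_zero.1 hy).const_mul C
  simpa using h_diff.add hx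

theorem tendsto_zero_of_dense_span (hS : ∀ᶠ i in l, ‖S i‖ ≤ C)
    (hD : Dense (Submodule.span 𝕜 D : Set X))
    (h : ∀ x ∈ D, Tendsto (fun i => S i x) l (𝓝 0)) (x : X) :
    Tendsto (fun i => S i x) l (𝓝 0) := by
  have h_span : ∀ y ∈ Submodule.span 𝕜 D, Tendsto (fun i => S i y) l (𝓝 0) := by
    intro y hy
    induction hy using Submodule.span_induction with
    | mem y hy => exact h y hy
    | zero => simpa using tendsto_const_nhds
    | add y z _ _ hy hz => simpa using hy.add hz
    | smul c y _ hy => simpa using hy.const_smul c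
  have h_nhds : Tendsto (fun y => C * ‖x - y‖) (𝓝 x) (𝓝 0) := by
    have h_cont : Continuous fun y => C * ‖x - y‖ := by fun_prop
    simpa using h_cont.tendsto x
  refine Metric.tendsto_nhds.2 fun ε hε => ?_
  obtain ⟨y, hy, hxy⟩ :=
    mem_closure_iff_nhds.1 (hD x) _ (h_nhds.eventually_lt_const (half_pos hε))
  filter_upwards [hS, Metric.tendsto_nhds.1 (h_span y hxy) _ (half_pos hε)] with i hi hiy
  rw [dist_zero_right] at hiy ⊢
  calc ‖S i x‖ = ‖S i (x - y) + S i y‖ := by rw [map_sub, sub_add_cancel]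
    _ ≤ C * ‖x - y‖ + ‖S i y‖ :=
        (norm_add_le _ _).trans (add_le_add_left ((S i).le_of_opNorm_le hi _) _)
    _ < ε / 2 + ε / 2 := add_lt_add hy hiy
    _ = ε := add_halves ε

theorem tendsto_of_dense_span (hS : ∀ᶠ i in l, ‖S i‖ ≤ C)
    (hD : Dense (Submodule.span 𝕜 D : Set X)) {R : X →L[𝕜] X}
    (h : ∀ x ∈ D, Tendsto (fun i => S i x) l (𝓝 (R x))) (x : X) :
    Tendsto (fun i => S i x) l (𝓝 (R x)) := by
  have h_bdd : ∀ᶠ i in l, ‖S i - R‖ ≤ C + ‖R‖ :=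
    hS.mono fun i hi => (norm_sub_le _ _).trans (add_le_add_left hi _)
  have h_sub := tendsto_zero_of_dense_span h_bdd hD
    (fun x hx => by simpa using tendsto_sub_nhds_zero_iff.2 (h x hx)) x
  exact tendsto_sub_nhds_zero_iff.1 h_sub

theorem exists_tendsto_of_dense_span [CompleteSpace X] [l.NeBot] (hS : ∀ i, ‖S i‖ ≤ C)
    (hD : Dense (Submodule.span 𝕜 D : Set X))
    (h : ∀ x ∈ D, ∃ y, Tendsto (fun i => S i x) l (𝓝 y)) (x : X) :
    ∃ y, Tendsto (fun i => S i x) l (𝓝 y) := by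
  have h_bdd : ∀ᶠ p in l ×ˢ l, ‖S p.1 - S p.2‖ ≤ C + C :=
    Eventually.of_forall fun p => (norm_sub_le _ _).trans (add_le_add (hS _) (hS _))
  have h_zero : Tendsto (fun p : I × I => (S p.1 - S p.2) x) (l ×ˢ l) (𝓝 0) := by
    refine tendsto_zero_of_dense_span h_bdd hD (fun y hy => ?_) x
    obtain ⟨w, hw⟩ := h y hy
    simpa using (hw.comp tendsto_fst).sub (hw.comp tendsto_snd)
  refine cauchy_map_iff_exists_tendsto.1 (cauchy_map_iff'.2 ?_)
  rw [tendsto_uniformity_iff_dist_tendsto_zero]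
  simpa [dist_eq_norm] using h_zero.norm

theorem exists_strong_limit [CompleteSpace X] [l.NeBot] (hS : ∀ i, ‖S i‖ ≤ C)
    (hD : Dense (Submodule.span 𝕜 D : Set X))
    (h : ∀ x ∈ D, ∃ y, Tendsto (fun i => S i x) l (𝓝 y)) :
    ∃ R : X →L[𝕜] X, (∀ x, Tendsto (fun i => S i x) l (𝓝 (R x))) ∧ ‖R‖ ≤ C := by
  choose f hf using exists_tendsto_of_dense_span hS hD h
  obtain ⟨i₀⟩ : Nonempty I := l.nonempty_of_neBot
  refine ⟨ContinuousLinearMap.ofTendstoOfBoundedRange f S (tendsto_pi_nhds.2 hf)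
    (isBounded_iff_forall_norm_le.2 ⟨C, Set.forall_mem_range.2 hS⟩), hf, ?_⟩
  exact ContinuousLinearMap.opNorm_le_bound _ ((norm_nonneg _).trans (hS i₀)) fun x =>
    le_of_tendsto (hf x).norm (Eventually.of_forall fun i => (S i).le_of_opNorm_le (hS i) x)

end StrongLimits

section NonDegenerate

variable {𝕜 B B' X : Type*} [RCLike 𝕜] [SeminormedAddCommGroup B] [NormedSpace 𝕜 B]
  [SeminormedAddCommGroup B'] [NormedSpace 𝕜 B'] [NormedAddCommGroup X] [NormedSpace 𝕜 X]
  {π : B →L[𝕜] X →L[𝕜] X} {π' : B' →L[𝕜] X →L[𝕜] X}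

theorem NonDegenerate.of_forall_mem_closure (hπ : NonDegenerate π)
    (h : ∀ b x, π b x ∈ closure (Submodule.span 𝕜 {y | ∃ b x, π' b x = y} : Set X)) :
    NonDegenerate π' := by
  refine dense_closure.1 (hπ.mono ?_)
  rw [← Submodule.topologicalClosure_coe, SetLike.coe_subset_coe, Submodule.span_le]
  rintro _ ⟨b, x, rfl⟩
  exact h b x

theorem NonDegenerate.ext (hπ : NonDegenerate π) {R S : X →L[𝕜] X}
    (h : ∀ b x, R (π b x) = S (π b x)) : R = S :=
  ContinuousLinearMap.ext_on hπ <| by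
    rintro _ ⟨b, x, rfl⟩
    exact h b x

theorem NonDegenerate.tendsto {I : Type*} {l : Filter I} (hπ : NonDegenerate π)
    {S : I → X →L[𝕜] X} {C : ℝ} (hS : ∀ᶠ i in l, ‖S i‖ ≤ C) {R : X →L[𝕜] X}
    (h : ∀ b x, Tendsto (fun i => S i (π b x)) l (𝓝 (R (π b x)))) (x : X) :
    Tendsto (fun i => S i x) l (𝓝 (R x)) :=
  tendsto_of_dense_span hS hπ (by rintro _ ⟨b, x, rfl⟩; exact h b x) x

end NonDegenerate

section WCc

variable {𝕜 G A : Type*} [RCLike 𝕜] [Group G] [TopologicalSpace G] [MeasurableSpace G]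
  [NonUnitalNormedRing A] [NormedSpace 𝕜 A] {μ : Measure G} {α : BddDynSystem 𝕜 G A} {ω : Weight G}

theorem WCc.add_apply (f g : WCc μ α ω) (r : G) : (f + g) r = f r + g r := rfl

theorem WCc.smul_apply (c : 𝕜) (f : WCc μ α ω) (r : G) : (c • f) r = c • f r := rfl

theorem toWCc_apply (f : C_c(G, A)) (r : G) : toWCc μ α ω f r = f r := rfl

variable [IsTopologicalGroup G] [BorelSpace G] [LocallyCompactSpace G] [μ.IsHaarMeasure]

theorem norm_toL1 (f : C_c(G, A)) : ‖toL1 μ α ω f‖ = ‖toWCc μ α ω f‖ :=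
  UniformSpace.Completion.norm_coe _

theorem denseRange_toL1 : DenseRange (toL1 μ α ω) :=
  UniformSpace.Completion.denseRange_coe (α := WCc μ α ω)

end WCc

section Tensor

variable {G A : Type*} [TopologicalSpace G] [NonUnitalNormedRing A] [NormedSpace ℝ A]

theorem tensor_apply (z : C_c(G, ℝ)) (a : A) (r : G) : tensor z a r = z r • a := rfl

variable [Group G] [IsTopologicalGroup G]

theorem transR_apply (z : C_c(G, ℝ)) (s r : G) : transR z s r = z (r * s⁻¹) := rfl

theorem transR_one (z : C_c(G, ℝ)) : transR z 1 = z := by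
  ext r
  rw [transR_apply, inv_one, mul_one]

theorem check_apply {𝕜 : Type*} [RCLike 𝕜] [LocallyCompactSpace G] [NormedSpace 𝕜 A]
    (α : BddDynSystem 𝕜 G A) (f : C_c(G, A)) (r : G) :
    check α f r = modulus r⁻¹ • α r (f r) := rfl

end Tensor

section NhdBase

variable {G : Type*} [Group G] [TopologicalSpace G] {𝒵 : Set (Set G)}

theorem IsCompactNhdBase.eventually_subset (h : IsCompactNhdBase 𝒵) {W : Set G}
    (hW : W ∈ 𝓝 (1 : G)) : ∀ᶠ V : (↥𝒵)ᵒᵈ in atTop, ((OrderDual.ofDual V : 𝒵) : Set G) ⊆ W := by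
  obtain ⟨V, hV, hVW⟩ := h.base W hW
  filter_upwards [mem_atTop (OrderDual.toDual (⟨V, hV⟩ : 𝒵))] with U hU
  exact Set.Subset.trans (show ((OrderDual.ofDual U : 𝒵) : Set G) ⊆ V from hU) hVW

theorem IsCompactNhdBase.neBot (h : IsCompactNhdBase 𝒵) :
    (atTop : Filter (↥𝒵)ᵒᵈ).NeBot := by
  have h_nonempty : Nonempty (↥𝒵)ᵒᵈ := by
    obtain ⟨V, hV, -⟩ := h.base Set.univ univ_mem
    exact ⟨OrderDual.toDual ⟨V, hV⟩⟩
  have h_directed : IsDirected (↥𝒵)ᵒᵈ (· ≤ ·) := ⟨fun V W => by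
    obtain ⟨U, hU, hUVW⟩ := h.base _ (inter_mem (h.mem_nhds _ (OrderDual.ofDual V).2)
      (h.mem_nhds _ (OrderDual.ofDual W).2))
    exact ⟨OrderDual.toDual ⟨U, hU⟩, fun r hr => (hUVW hr).1, fun r hr => (hUVW hr).2⟩⟩
  infer_instance

variable (G) in
theorem exists_isCompactNhdBase [LocallyCompactSpace G] :
    ∃ 𝒵 : Set (Set G), IsCompactNhdBase 𝒵 := by
  obtain ⟨K, hK, hK1⟩ := exists_compact_mem_nhds (1 : G)
  exact ⟨{V | V ∈ 𝓝 1 ∧ V ⊆ K}, fun V hV => hV.1,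
    fun W hW => ⟨W ∩ K, ⟨inter_mem hW hK1, Set.inter_subset_right⟩, Set.inter_subset_left⟩,
    K, hK, fun V hV => hV.2⟩

variable [IsTopologicalGroup G] [LocallyCompactSpace G] [MeasurableSpace G] [BorelSpace G]
  (μ : Measure G) [μ.IsHaarMeasure]

theorem exists_nonneg_support_subset_integral_inv_eq_one {V : Set G} (hV : V ∈ 𝓝 1) :
    ∃ z : C_c(G, ℝ), (∀ r, 0 ≤ z r) ∧ Function.support z ⊆ V ∧ ∫ r, z r⁻¹ ∂μ = 1 := by
  have h_disj : Disjoint {(1 : G)} (interior V)ᶜ := by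
    simpa [Set.disjoint_singleton_left, mem_interior_iff_mem_nhds] using hV
  obtain ⟨f, hf_one, hf_zero, hfs, hf_mem⟩ := exists_continuous_one_zero_of_isCompact
    isCompact_singleton isOpen_interior.isClosed_compl h_disj
  have h_pos : 0 < ∫ r, f r⁻¹ ∂μ := by
    refine (f.continuous.comp continuous_inv).integral_pos_of_hasCompactSupport_nonneg_nonzero
      (hfs.comp_homeomorph (Homeomorph.inv G)) (fun r => (hf_mem _).1) (x := 1) ?_
    simp [hf_one (Set.mem_singleton 1)]
  have h_supp : Function.support f ⊆ V := fun r hr =>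
    interior_subset (by_contra fun hrV => hr (hf_zero hrV))
  refine ⟨(∫ r, f r⁻¹ ∂μ)⁻¹ • ⟨f, hfs⟩, fun r => ?_, fun r hr => h_supp ?_, ?_⟩
  · exact mul_nonneg (inv_nonneg.2 h_pos.le) (hf_mem r).1
  · exact right_ne_zero_of_mul hr
  · exact (integral_const_mul _ _).trans (inv_mul_cancel₀ h_pos.ne')

theorem exists_isBumpFamily (h : IsCompactNhdBase 𝒵) :
    ∃ z : 𝒵 → C_c(G, ℝ), IsBumpFamily μ 𝒵 z := by
  choose z hz using fun V : 𝒵 =>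
    exists_nonneg_support_subset_integral_inv_eq_one μ (h.mem_nhds V V.2)
  exact ⟨z, fun V => (hz V).1, fun V => (hz V).2.1, fun V => (hz V).2.2⟩

end NhdBase

section Averages

variable {G E : Type*} [TopologicalSpace G] [MeasurableSpace G] [BorelSpace G] {μ : Measure G}
  [IsFiniteMeasureOnCompacts μ] [NormedAddCommGroup E] [NormedSpace ℝ E] [CompleteSpace E]

theorem norm_integral_smul_sub_le {p : G → ℝ} (hp : Continuous p) (hps : HasCompactSupport p)
    (hp_nonneg : ∀ r, 0 ≤ p r) (hp_one : ∫ r, p r ∂μ = 1) {F : G → E} (hF : Continuous F)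
    {y : E} {ε : ℝ} (hε : ∀ r, p r ≠ 0 → ‖F r - y‖ ≤ ε) : ‖∫ r, p r • F r ∂μ - y‖ ≤ ε := by
  have hp_int : Integrable p μ := hp.integrable_of_hasCompactSupport hps
  have h_int : Integrable (fun r => p r • F r) μ :=
    (hp.smul hF).integrable_of_hasCompactSupport hps.smul_right
  have h_sub : ∫ r, p r • F r ∂μ - y = ∫ r, p r • (F r - y) ∂μ := by
    simp only [smul_sub]
    rw [integral_sub h_int (hp_int.smul_const y), integral_smul_const, hp_one, one_smul]
  calc ‖∫ r, p r • F r ∂μ - y‖ ≤ ∫ r, p r * ε ∂μ := by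
        rw [h_sub]
        refine norm_integral_le_of_norm_le (hp_int.mul_const ε) (Eventually.of_forall fun r => ?_)
        rw [norm_smul, Real.norm_of_nonneg (hp_nonneg r)]
        by_cases h : p r = 0
        · simp [h]
        · exact mul_le_mul_of_nonneg_left (hε r h) (hp_nonneg r)
    _ = ε := by rw [integral_mul_const, hp_one, one_mul]

end Averages

section Bump

variable {G : Type*} [Group G] [TopologicalSpace G] [IsTopologicalGroup G]
  [LocallyCompactSpace G] [MeasurableSpace G] [BorelSpace G] {μ : Measure G} [μ.IsHaarMeasure]
  {𝒵 : Set (Set G)} {z : 𝒵 → C_c(G, ℝ)}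

theorem IsBumpFamily.integral_modulus (hz : IsBumpFamily μ 𝒵 z) (V : 𝒵) :
    ∫ r, modulus r⁻¹ * z V r ∂μ = 1 :=
  (integral_inv_eq_integral_modulus_inv_mul (z V).continuous (z V).hasCompactSupport).symm.trans
    (hz.integral_inv V)

theorem IsBumpFamily.tendsto_integral {E : Type*} [NormedAddCommGroup E] [NormedSpace ℝ E]
    [CompleteSpace E] (hz : IsBumpFamily μ 𝒵 z) (h𝒵 : IsCompactNhdBase 𝒵) {F : G → E}
    (hF : Continuous F) :
    Tendsto (fun V : (↥𝒵)ᵒᵈ => ∫ r, (modulus r⁻¹ * z (OrderDual.ofDual V) r) • F r ∂μ) atTop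
      (𝓝 (F 1)) := by
  refine Metric.tendsto_nhds.2 fun ε hε => ?_
  have h_near : {r | ‖F r - F 1‖ < ε / 2} ∈ 𝓝 (1 : G) :=
    (isOpen_lt (by fun_prop) continuous_const).mem_nhds (by simpa using hε)
  filter_upwards [h𝒵.eventually_subset h_near] with V hV
  rw [dist_eq_norm]
  refine lt_of_le_of_lt (norm_integral_smul_sub_le (continuous_modulus_inv.mul (z _).continuous)
    (z _).hasCompactSupport.mul_left (fun r => mul_nonneg (modulus_pos _).le (hz.nonneg _ r))
    (hz.integral_modulus _) hF fun r hr => ?_) (half_lt_self hε)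
  exact (hV (hz.supp _ (right_ne_zero_of_mul hr))).le

end Bump

namespace AAPair

section Basic

variable {𝕜 G A X : Type*} [RCLike 𝕜] [Group G] [TopologicalSpace G] [MeasurableSpace G]
  [NonUnitalNormedRing A] [NormedSpace 𝕜 A] [NormedAddCommGroup X] [NormedSpace 𝕜 X]
  {α : BddDynSystem 𝕜 G A} {ω : Weight G} (P : AAPair α ω X)

theorem ext {P Q : AAPair α ω X} (hπ : P.π = Q.π) (hU : P.U = Q.U) : P = Q := by
  cases P
  cases Q
  congr

theorem nonneg_of_norm_le {C : ℝ} (hC : ∀ r, ‖P.U r‖ ≤ C * ω r) : 0 ≤ C :=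
  nonneg_of_mul_nonneg_left ((norm_nonneg _).trans (hC 1)) (one_pos.trans_le ω.one_le_one)

theorem π_mul_apply (a b : A) (x : X) : P.π (a * b) x = P.π b (P.π a x) := by
  rw [P.π_mul]
  rfl

theorem U_mul_apply (r s : G) (x : X) : P.U (r * s) x = P.U s (P.U r x) := by
  rw [P.U_mul]
  rfl

theorem U_one_apply (x : X) : P.U 1 x = x := by
  rw [P.U_one]
  rfl

theorem U_π (r : G) (a : A) (x : X) : P.U r (P.π (α r a) x) = P.π a (P.U r x) := by
  have h_cov := DFunLike.congr_fun (P.covariant r (α r a)) (P.U r x)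
  rw [α.inv_apply_apply] at h_cov
  rw [← h_cov, mul_apply_eq_comp, mul_apply_eq_comp, ← P.U_mul_apply,
    mul_inv_cancel, P.U_one_apply]

theorem continuous_uncurry [IsTopologicalGroup G] [LocallyCompactSpace G] [BorelSpace G] :
    Continuous fun p : G × X => P.U p.1 p.2 := by
  obtain ⟨C, hC⟩ := P.U_bdd
  refine continuous_iff_continuousAt.2 fun ⟨r, x⟩ => ?_
  obtain ⟨D, hD⟩ := ω.exists_eventually_le r
  have h_bdd : ∀ᶠ p : G × X in 𝓝 (r, x), ‖P.U p.1‖ ≤ C * D :=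
    (continuous_fst.tendsto (r, x)).eventually hD |>.mono fun p hp =>
      (hC p.1).trans (mul_le_mul_of_nonneg_left hp (P.nonneg_of_norm_le hC))
  exact tendsto_apply_of_tendsto h_bdd (continuous_snd.tendsto (r, x))
    (((P.U_cont x).comp continuous_fst).tendsto (r, x))

theorem tendsto_π_of_approxRightId {I : Type*} [Preorder I] {u : I → A}
    (hu : IsBddApproxRightId u) (x : X) : Tendsto (fun i => P.π (u i) x) atTop (𝓝 x) := by
  obtain ⟨M, hM⟩ := hu.bdd
  refine P.π_nondeg.tendsto (C := ‖P.π‖ * M) (R := ContinuousLinearMap.id 𝕜 X)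
    (Eventually.of_forall fun i => P.π.le_of_opNorm_le_of_le le_rfl (hM i)) (fun a y => ?_) x
  have h_mul : Tendsto (fun i => P.π (a * u i) y) atTop (𝓝 (P.π a y)) :=
    ((P.π.flip y).continuous.tendsto a).comp (hu.tendsto a)
  simpa only [P.π_mul_apply, ContinuousLinearMap.id_apply] using h_mul

end Basic

end AAPair

namespace AAPair

section IntegratedForm

variable {𝕜 G A X : Type*} [RCLike 𝕜] [Group G] [TopologicalSpace G] [IsTopologicalGroup G]
  [LocallyCompactSpace G] [MeasurableSpace G] [BorelSpace G]
  [NonUnitalNormedRing A] [NormedSpace 𝕜 A] [NormedAddCommGroup X] [NormedSpace 𝕜 X]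
  {α : BddDynSystem 𝕜 G A} {ω : Weight G} (μ : Measure G) [μ.IsHaarMeasure] (P : AAPair α ω X)

theorem integrable_integrand (f : WCc μ α ω) (x : X) :
    Integrable (fun r => P.U r (P.π (f r) x)) μ :=
  (P.continuous_uncurry.comp (continuous_id.prodMk
    ((P.π.flip x).continuous.comp f.continuous))).integrable_of_hasCompactSupport
    (f.hasCompactSupport.mono fun r hr h_zero => hr (by simp [h_zero]))

variable [NormedSpace ℝ X]

theorem norm_integral_integrand_le {C : ℝ} (hC : ∀ r, ‖P.U r‖ ≤ C * ω r) (f : WCc μ α ω) (x : X) :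
    ‖∫ r, P.U r (P.π (f r) x) ∂μ‖ ≤ C * ‖P.π‖ * ‖f‖ * ‖x‖ := by
  have h_pointwise (r : G) : ‖P.U r (P.π (f r) x)‖ ≤ C * ‖P.π‖ * ‖x‖ * (‖f r‖ * ω r) :=
    calc ‖P.U r (P.π (f r) x)‖ ≤ C * ω r * (‖P.π‖ * ‖f r‖ * ‖x‖) :=
          (P.U r).le_of_opNorm_le_of_le (hC r) (P.π.le_opNorm₂ _ _)
      _ = C * ‖P.π‖ * ‖x‖ * (‖f r‖ * ω r) := by ring
  calc ‖∫ r, P.U r (P.π (f r) x) ∂μ‖ ≤ ∫ r, C * ‖P.π‖ * ‖x‖ * (‖f r‖ * ω r) ∂μ :=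
        norm_integral_le_of_norm_le (f.integrable.const_mul _) (Eventually.of_forall h_pointwise)
    _ = C * ‖P.π‖ * ‖f‖ * ‖x‖ := by rw [integral_const_mul, WCc.norm_def]; ring

theorem tendsto_integral_bump_smul_U [CompleteSpace X] {𝒵 : Set (Set G)} {z : 𝒵 → C_c(G, ℝ)}
    (h𝒵 : IsCompactNhdBase 𝒵) (hz : IsBumpFamily μ 𝒵 z) (s : G) (x : X) :
    Tendsto (fun V : (↥𝒵)ᵒᵈ =>
      ∫ r, (modulus r⁻¹ * z (OrderDual.ofDual V) r) • P.U (r * s) x ∂μ) atTop (𝓝 (P.U s x)) := by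
  simpa using hz.tendsto_integral h𝒵 ((P.U_cont x).comp (continuous_mul_const s))

variable [IsScalarTower ℝ 𝕜 X]

/-- The integrated form `f ↦ ∫ U_r π(f(r)) dr` of a pair `(π, U)` on `C_c(G, A)`. -/
def integratedCc : WCc μ α ω →L[𝕜] X →L[𝕜] X :=
  LinearMap.mkContinuousOfExistsBound₂
    (LinearMap.mk₂ 𝕜 (fun (f : WCc μ α ω) x => ∫ r, P.U r (P.π (f r) x) ∂μ)
      (fun f g x => by
        simp only [WCc.add_apply, map_add, add_apply]
        exact integral_add (P.integrable_integrand μ f x) (P.integrable_integrand μ g x))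
      (fun c f x => by
        simp only [WCc.smul_apply, map_smul, smul_apply]
        exact integral_smul c _)
      (fun f x y => by
        simp only [map_add]
        exact integral_add (P.integrable_integrand μ f x) (P.integrable_integrand μ f y))
      (fun c f x => by
        simp only [map_smul]
        exact integral_smul c _))
    (by
      obtain ⟨C, hC⟩ := P.U_bdd
      exact ⟨C * ‖P.π‖, P.norm_integral_integrand_le μ hC⟩)

theorem integratedCc_apply (f : WCc μ α ω) (x : X) :
    P.integratedCc μ f x = ∫ r, P.U r (P.π (f r) x) ∂μ := rfl

/-- The integrated form of a pair `(π, U)` on `L¹(G, A, ω; α)`. -/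
def integrated [CompleteSpace X] : GenBeurling μ α ω →L[𝕜] X →L[𝕜] X :=
  (P.integratedCc μ).extend UniformSpace.Completion.toComplL

variable [CompleteSpace X]

theorem integrated_toL1 (f : C_c(G, A)) :
    P.integrated μ (toL1 μ α ω f) = P.integratedCc μ (toWCc μ α ω f) :=
  (P.integratedCc μ).extend_eq UniformSpace.Completion.denseRange_coe
    (UniformSpace.Completion.isUniformInducing_coe _) _

theorem integrated_toL1_apply (f : C_c(G, A)) (x : X) :
    P.integrated μ (toL1 μ α ω f) x = ∫ r, P.U r (P.π (f r) x) ∂μ := by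
  rw [integrated_toL1, integratedCc_apply]
  rfl

theorem norm_integrated_le {C : ℝ} (hC : ∀ r, ‖P.U r‖ ≤ C * ω r) :
    ‖P.integrated μ‖ ≤ C * ‖P.π‖ := by
  have hC_nonneg := P.nonneg_of_norm_le hC
  refine ContinuousLinearMap.opNorm_le_bound _ (by positivity) fun b => ?_
  refine denseRange_toL1.induction_on b (isClosed_le (by fun_prop) (by fun_prop)) fun f => ?_
  rw [integrated_toL1, norm_toL1]
  exact ContinuousLinearMap.opNorm_le_bound _ (by positivity)
    (P.norm_integral_integrand_le μ hC (toWCc μ α ω f))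

variable [NormedSpace ℝ A] [IsScalarTower ℝ 𝕜 A]

theorem integrated_check_tensor (z : C_c(G, ℝ)) (s : G) (b : A) (x : X) :
    P.integrated μ (toL1 μ α ω (check α (tensor (transR z s) b))) x =
      P.π b (∫ r, (modulus r⁻¹ * z r) • P.U (r * s) x ∂μ) := by
  have h_cont : Continuous fun r => P.U (r * s) x := (P.U_cont x).comp (continuous_mul_const s)
  have h_int : Integrable (fun r => (modulus r⁻¹ * z r) • P.U (r * s) x) μ :=
    ((continuous_modulus_inv.mul z.continuous).smul h_cont).integrable_of_hasCompactSupport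
      z.hasCompactSupport.mul_left.smul_right
  have h_covariant (r : G) : P.U r (P.π (check α (tensor (transR z s) b) r) x) =
      modulus r⁻¹ • z (r * s⁻¹) • P.π b (P.U r x) := by
    simp only [check_apply, tensor_apply, transR_apply, (α r).map_smul_of_tower,
      ← P.π.flip_apply _ x, (P.π.flip x).map_smul_of_tower, (P.U r).map_smul_of_tower]
    rw [P.π.flip_apply, P.U_π]
  have hs : HasCompactSupport fun r => z (r * s⁻¹) • P.π b (P.U r x) :=
    (transR z s).hasCompactSupport.smul_right
  simp only [integrated_toL1_apply, h_covariant]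
  rw [← integral_modulus_inv_smul_mul_right hs s, ← (P.π b).integral_comp_comm h_int]
  simp only [mul_inv_cancel_right, smul_smul, (P.π b).map_smul_of_tower]

section Bump

variable {𝒵 : Set (Set G)} {z : 𝒵 → C_c(G, ℝ)}

theorem tendsto_integrated_check_tensor (h𝒵 : IsCompactNhdBase 𝒵) (hz : IsBumpFamily μ 𝒵 z)
    (s : G) (b : A) (x : X) :
    Tendsto (fun V : (↥𝒵)ᵒᵈ => P.integrated μ (toL1 μ α ω
      (check α (tensor (transR (z (OrderDual.ofDual V)) s) b))) x) atTop
      (𝓝 (P.π b (P.U s x))) := by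
  simp only [integrated_check_tensor]
  exact ((P.π b).continuous.tendsto _).comp (P.tendsto_integral_bump_smul_U μ h𝒵 hz s x)

theorem tendsto_integrated_check_tensor_prod (h𝒵 : IsCompactNhdBase 𝒵)
    (hz : IsBumpFamily μ 𝒵 z) {I : Type*} [Preorder I] {b : I → A} {M : ℝ}
    (hM : ∀ i, ‖b i‖ ≤ M) (s : G) {x w : X}
    (hw : Tendsto (fun i => P.π (b i) (P.U s x)) atTop (𝓝 w)) :
    Tendsto (fun p : (↥𝒵)ᵒᵈ × I => P.integrated μ (toL1 μ α ω
      (check α (tensor (transR (z (OrderDual.ofDual p.1)) s) (b p.2)))) x) atTop (𝓝 w) := by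
  simp only [integrated_check_tensor, ← prod_atTop_atTop_eq]
  exact tendsto_apply_of_tendsto (S := fun p : (↥𝒵)ᵒᵈ × I => P.π (b p.2)) (C := ‖P.π‖ * M)
    (Eventually.of_forall fun p => P.π.le_of_opNorm_le_of_le le_rfl (hM p.2))
    ((P.tendsto_integral_bump_smul_U μ h𝒵 hz s x).comp tendsto_fst) (hw.comp tendsto_snd)

theorem tendsto_integrated_U (h𝒵 : IsCompactNhdBase 𝒵) (hz : IsBumpFamily μ 𝒵 z) {I : Type*}
    [Preorder I] {u : I → A} (hu : IsBddApproxRightId u) (s : G) (x : X) :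
    Tendsto (fun p : (↥𝒵)ᵒᵈ × I => P.integrated μ (toL1 μ α ω
      (check α (tensor (transR (z (OrderDual.ofDual p.1)) s) (u p.2)))) x) atTop
      (𝓝 (P.U s x)) := by
  obtain ⟨M, hM⟩ := hu.bdd
  exact P.tendsto_integrated_check_tensor_prod μ h𝒵 hz hM s
    (P.tendsto_π_of_approxRightId hu (P.U s x))

theorem tendsto_integrated_π (h𝒵 : IsCompactNhdBase 𝒵) (hz : IsBumpFamily μ 𝒵 z) {I : Type*}
    [Preorder I] {u : I → A} (hu : IsBddApproxRightId u) (a : A) (x : X) :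
    Tendsto (fun p : (↥𝒵)ᵒᵈ × I => P.integrated μ (toL1 μ α ω
      (check α (tensor (z (OrderDual.ofDual p.1)) (u p.2 * a)))) x) atTop (𝓝 (P.π a x)) := by
  obtain ⟨M, hM⟩ := hu.bdd
  have h_bdd (i : I) : ‖u i * a‖ ≤ M * ‖a‖ := norm_mul_le_of_le (hM i) le_rfl
  have h_lim : Tendsto (fun i => P.π (u i * a) (P.U 1 x)) atTop (𝓝 (P.π a x)) := by
    simp only [P.π_mul_apply, P.U_one_apply]
    exact ((P.π a).continuous.tendsto x).comp (P.tendsto_π_of_approxRightId hu x)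
  simpa only [transR_one] using P.tendsto_integrated_check_tensor_prod μ h𝒵 hz h_bdd 1 h_lim

end Bump

theorem nonDegenerate_integrated : NonDegenerate (P.integrated μ) := by
  obtain ⟨𝒵, h𝒵⟩ := exists_isCompactNhdBase G
  obtain ⟨z, hz⟩ := exists_isBumpFamily μ h𝒵
  have := h𝒵.neBot
  refine P.π_nondeg.of_forall_mem_closure fun a x => ?_
  have h_lim := P.tendsto_integrated_check_tensor μ h𝒵 hz 1 a x
  rw [P.U_one_apply] at h_lim
  exact mem_closure_of_tendsto h_lim
    (Eventually.of_forall fun V => Submodule.subset_span ⟨_, _, rfl⟩)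

theorem integrated_injective {J : Type*} [Preorder J] [IsDirected J (· ≤ ·)] [Nonempty J]
    {v : J → A} (hv : IsBddApproxRightId v) :
    Function.Injective fun P : AAPair α ω X => P.integrated μ := by
  intro P Q (hPQ : P.integrated μ = Q.integrated μ)
  obtain ⟨𝒵, h𝒵⟩ := exists_isCompactNhdBase G
  obtain ⟨z, hz⟩ := exists_isBumpFamily μ h𝒵
  have := h𝒵.neBot
  have h_mul (b : A) (s : G) (x : X) : P.π b (P.U s x) = Q.π b (Q.U s x) :=
    tendsto_nhds_unique (P.tendsto_integrated_check_tensor μ h𝒵 hz s b x)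
      (hPQ ▸ Q.tendsto_integrated_check_tensor μ h𝒵 hz s b x)
  have hπ : P.π = Q.π := by
    ext a x
    simpa only [U_one_apply] using h_mul a 1 x
  refine ext hπ (funext fun s => ContinuousLinearMap.ext fun x => ?_)
  refine tendsto_nhds_unique (P.tendsto_π_of_approxRightId hv (P.U s x)) ?_
  simp only [h_mul]
  exact Q.tendsto_π_of_approxRightId hv (Q.U s x)

end IntegratedForm

section Multiplicative

variable {𝕜 G A X : Type*} [RCLike 𝕜] [Group G] [TopologicalSpace G] [IsTopologicalGroup G]
  [LocallyCompactSpace G] [MeasurableSpace G] [BorelSpace G]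
  [NonUnitalNormedRing A] [NormedSpace 𝕜 A] [CompleteSpace A] [NormedSpace ℝ A]
  [NormedAddCommGroup X] [NormedSpace 𝕜 X] [CompleteSpace X] [NormedSpace ℝ X]
  [IsScalarTower ℝ 𝕜 X] {α : BddDynSystem 𝕜 G A} {ω : Weight G}
  (μ : Measure G) [μ.IsHaarMeasure] (P : AAPair α ω X)

theorem integratedCc_conv (f g : C_c(G, A)) (x : X) :
    P.integratedCc μ (toWCc μ α ω (conv μ α f g)) x =
      P.integratedCc μ (toWCc μ α ω g) (P.integratedCc μ (toWCc μ α ω f) x) := by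
  have h_inner_s (s : G) : P.U s (P.π (conv μ α f g s) x) =
      ∫ r, P.U s (P.π (f r * α r (g (r⁻¹ * s))) x) ∂μ :=
    (((P.U s).comp (P.π.flip x)).integral_comp_comm (conv_integrable μ α f g s)).symm
  have h_inner_r (r : G) : ∫ s, P.U s (P.π (f r * α r (g (r⁻¹ * s))) x) ∂μ =
      P.integratedCc μ (toWCc μ α ω g) (P.U r (P.π (f r) x)) := by
    rw [← integral_mul_left_eq_self _ r, integratedCc_apply]
    simp only [inv_mul_cancel_left, P.π_mul_apply, P.U_mul_apply, P.U_π, toWCc_apply]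
  have h_cont : Continuous (Function.uncurry fun s r =>
      P.U s (P.π (f r * α r (g (r⁻¹ * s))) x)) :=
    P.continuous_uncurry.comp (continuous_fst.prodMk
      ((P.π.flip x).continuous.comp (conv_continuous_uncurry α f g)))
  have h_supp : HasCompactSupport (Function.uncurry fun s r =>
      P.U s (P.π (f r * α r (g (r⁻¹ * s))) x)) := by
    refine HasCompactSupport.intro ((f.hasCompactSupport.isCompact.mul
      g.hasCompactSupport.isCompact).prod f.hasCompactSupport) fun ⟨s, r⟩ h_notMem => ?_
    by_contra h_ne
    obtain ⟨hf, hg⟩ := conv_support α f g s r fun h_zero => h_ne (by simp [h_zero])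
    exact h_notMem ⟨⟨r, subset_tsupport _ hf, r⁻¹ * s, subset_tsupport _ hg, by simp⟩,
      subset_tsupport _ hf⟩
  calc P.integratedCc μ (toWCc μ α ω (conv μ α f g)) x
      = ∫ s, ∫ r, P.U s (P.π (f r * α r (g (r⁻¹ * s))) x) ∂μ ∂μ :=
        integral_congr_ae (Eventually.of_forall h_inner_s)
    _ = ∫ r, ∫ s, P.U s (P.π (f r * α r (g (r⁻¹ * s))) x) ∂μ ∂μ :=
        integral_integral_swap_of_hasCompactSupport h_cont h_supp
    _ = ∫ r, P.integratedCc μ (toWCc μ α ω g) (P.U r (P.π (f r) x)) ∂μ := by simp only [h_inner_r]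
    _ = P.integratedCc μ (toWCc μ α ω g) (P.integratedCc μ (toWCc μ α ω f) x) :=
        (P.integratedCc μ (toWCc μ α ω g)).integral_comp_comm
          (P.integrable_integrand μ (toWCc μ α ω f) x)

variable [IsScalarTower 𝕜 A A] [SMulCommClass 𝕜 A A] [IsScalarTower ℝ 𝕜 A]

theorem integrated_mul (b c : GenBeurling μ α ω) :
    P.integrated μ (b * c) = P.integrated μ c * P.integrated μ b := by
  refine denseRange_toL1.induction_on₂ ?_ (fun f g => ?_) b c
  · exact isClosed_eq ((P.integrated μ).continuous.comp (GenBeurling.continuous_mul μ α ω))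
      (((P.integrated μ).continuous.comp continuous_snd).mul
        ((P.integrated μ).continuous.comp continuous_fst))
  · simp only [GenBeurling.toL1_mul, integrated_toL1]
    exact ContinuousLinearMap.ext (P.integratedCc_conv μ f g)

/-- The anti-representation of `L¹(G, A, ω; α)` integrated from a pair `(π, U)`. -/
def toAntiRep : AntiRep μ α ω X where
  T := P.integrated μ
  T_mul := P.integrated_mul μ
  T_nondeg := P.nonDegenerate_integrated μ

theorem toAntiRep_injective {J : Type*} [Preorder J] [IsDirected J (· ≤ ·)] [Nonempty J]
    {v : J → A} (hv : IsBddApproxRightId v) :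
    Function.Injective fun P : AAPair α ω X => P.toAntiRep μ := fun _ _ hPQ =>
  integrated_injective μ hv (congrArg AntiRep.T hPQ)

end Multiplicative

end AAPair

section WeightedNorm

variable {𝕜 G A : Type*} [RCLike 𝕜] [Group G] [TopologicalSpace G] [LocallyCompactSpace G]
  [IsTopologicalGroup G] [MeasurableSpace G] [BorelSpace G] [NonUnitalNormedRing A]
  [NormedSpace 𝕜 A] {μ : Measure G} [μ.IsHaarMeasure] {α : BddDynSystem 𝕜 G A} {ω : Weight G}

theorem norm_toWCc_le_of_norm_le {h : G → ℝ} (hc : Continuous h) (hs : HasCompactSupport h)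
    {f : C_c(G, A)} (hf : ∀ r, ‖f r‖ ≤ h r) : ‖toWCc μ α ω f‖ ≤ ∫ r, h r * ω r ∂μ :=
  integral_mono (toWCc μ α ω f).integrable (integrable_mul_weight μ ω h hc hs) fun r =>
    mul_le_mul_of_nonneg_right (hf r) (ω.nonneg' r)

variable (μ α ω) in
theorem exists_norm_toWCc_le {K : Set G} (hK : IsCompact K) :
    ∃ c : ℝ, ∀ (f : C_c(G, A)) (ε : ℝ), 0 ≤ ε → (∀ r ∉ K, f r = 0) → (∀ r ∈ K, ‖f r‖ ≤ ε) →
      ‖toWCc μ α ω f‖ ≤ c * ε := by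
  obtain ⟨χ, hχ_one, -, hχs, hχ_mem⟩ :=
    exists_continuous_one_zero_of_isCompact hK isClosed_empty (Set.disjoint_empty K)
  refine ⟨∫ r, χ r * ω r ∂μ, fun f ε hε hf hfε => ?_⟩
  have h_le (r : G) : ‖f r‖ ≤ ε * χ r := by
    by_cases hr : r ∈ K
    · simpa only [hχ_one hr, Pi.one_apply, mul_one] using hfε r hr
    · simpa only [hf r hr, norm_zero] using mul_nonneg hε (hχ_mem r).1
  refine (norm_toWCc_le_of_norm_le (h := fun r => ε * χ r)
    (continuous_const.mul χ.continuous) hχs.mul_left h_le).trans_eq ?_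
  rw [← integral_mul_const]
  exact integral_congr_ae (Eventually.of_forall fun r => by ring)

theorem tendsto_toWCc {I : Type*} {l : Filter I} {F : I → C_c(G, A)} {F₀ : C_c(G, A)} {K : Set G}
    (hK : IsCompact K) (hF₀ : ∀ r ∉ K, F₀ r = 0) (hF : ∀ᶠ i in l, ∀ r ∉ K, F i r = 0)
    (h : TendstoUniformlyOn (fun i r => F i r) F₀ l K) :
    Tendsto (fun i => toWCc μ α ω (F i)) l (𝓝 (toWCc μ α ω F₀)) := by
  obtain ⟨c, hc⟩ := exists_norm_toWCc_le μ α ω hK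
  refine Metric.tendsto_nhds.2 fun ε hε => ?_
  obtain ⟨δ, hδ, hcδ⟩ := exists_pos_mul_lt hε c
  filter_upwards [hF, Metric.tendstoUniformlyOn_iff.1 h δ hδ] with i hi_zero hi
  rw [dist_eq_norm]
  refine (hc (F i - F₀) δ hδ.le (fun r hr => ?_) fun r hr => ?_).trans_lt hcδ
  · exact sub_eq_zero.2 ((hi_zero r hr).trans (hF₀ r hr).symm)
  · exact (dist_eq_norm' _ _).symm.trans_le (hi r hr).le

end WeightedNorm

theorem tendstoUniformlyOn_of_continuous_uncurry {Q Y E : Type*} [TopologicalSpace Q]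
    [TopologicalSpace Y] [UniformSpace E] {F : Q → Y → E} (hF : Continuous F.uncurry) {K : Set Y}
    (hK : IsCompact K) (q : Q) : TendstoUniformlyOn F (F q) (𝓝 q) K :=
  ContinuousMap.tendsto_iff_forall_isCompact_tendstoUniformlyOn.1
    ((ContinuousMap.curry ⟨_, hF⟩).continuous.tendsto q) K hK

section Multipliers

variable {𝕜 G A : Type*} [RCLike 𝕜] [Group G] [TopologicalSpace G] [NonUnitalNormedRing A]
  [NormedSpace 𝕜 A] {α : BddDynSystem 𝕜 G A}

/-- The right action `r ↦ f(r) α_r(a)` of `a ∈ A` on `f ∈ C_c(G, A)`. It commutes with left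
convolutions, and it is what `π(a)` becomes under the disintegration of a representation. -/
def mulRight (α : BddDynSystem 𝕜 G A) (a : A) (f : C_c(G, A)) : C_c(G, A) where
  toFun r := f r * α r a
  continuous_toFun := f.continuous.mul (α.strong_cont' a)
  hasCompactSupport' := f.hasCompactSupport.mul_right

theorem mulRight_apply (a : A) (f : C_c(G, A)) (r : G) : mulRight α a f r = f r * α r a := rfl

theorem mulRight_apply_eq_apply_mul (a : A) (f : C_c(G, A)) (r : G) :
    mulRight α a f r = α r (α r⁻¹ (f r) * a) := by
  have h_inv := α.inv_apply_apply r⁻¹ (f r)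
  rw [inv_inv] at h_inv
  rw [α.map_mul', h_inv, mulRight_apply]

variable [IsTopologicalGroup G] [LocallyCompactSpace G]

/-- The right translate `r ↦ Δ(s⁻¹) f(r s⁻¹)` of `f ∈ C_c(G, A)` by `s ∈ G`, normalized to
preserve the `L¹`-norm. It commutes with left convolutions, and it is what `U_s` becomes under the
disintegration of a representation. -/
def translateRight [NormedSpace ℝ A] (s : G) (f : C_c(G, A)) : C_c(G, A) where
  toFun r := modulus s⁻¹ • f (r * s⁻¹)
  continuous_toFun := (f.continuous.comp (continuous_mul_const s⁻¹)).const_smul _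
  hasCompactSupport' :=
    (f.hasCompactSupport.comp_homeomorph (Homeomorph.mulRight s⁻¹)).smul_left
      (f := fun _ => modulus s⁻¹)

theorem translateRight_apply [NormedSpace ℝ A] (s : G) (f : C_c(G, A)) (r : G) :
    translateRight s f r = modulus s⁻¹ • f (r * s⁻¹) := rfl

variable [MeasurableSpace G] [BorelSpace G] {μ : Measure G} [μ.IsHaarMeasure] {ω : Weight G}

theorem norm_mulRight_le {C : ℝ} (hC : ∀ s, ‖α s‖ ≤ C) (a : A) (f : C_c(G, A)) :
    ‖toWCc μ α ω (mulRight α a f)‖ ≤ C * ‖a‖ * ‖toWCc μ α ω f‖ := by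
  refine (norm_toWCc_le_of_norm_le (h := fun r => C * ‖a‖ * ‖f r‖)
    (continuous_const.mul f.continuous.norm) f.hasCompactSupport.norm.mul_left
    fun r => ?_).trans_eq ?_
  · exact (norm_mul_le_of_le le_rfl ((α r).le_of_opNorm_le (hC r) a)).trans_eq (mul_comm _ _)
  · simp only [mul_assoc, integral_const_mul, WCc.norm_def, toWCc_apply]

variable [NormedSpace ℝ A]

theorem norm_translateRight_le (s : G) (f : C_c(G, A)) :
    ‖toWCc μ α ω (translateRight s f)‖ ≤ ω s * ‖toWCc μ α ω f‖ := by
  have hs : HasCompactSupport fun r => ‖f (r * s⁻¹)‖ * ω r :=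
    (f.hasCompactSupport.comp_homeomorph (Homeomorph.mulRight s⁻¹)).norm.mul_right
  have h_change : ∫ r, ‖translateRight s f r‖ * ω r ∂μ = ∫ r, ‖f r‖ * ω (r * s) ∂μ := by
    have h_norm (r : G) : ‖translateRight s f r‖ = modulus s⁻¹ * ‖f (r * s⁻¹)‖ := by
      rw [translateRight_apply, norm_smul, Real.norm_of_nonneg (modulus_pos _).le]
    simp only [h_norm, mul_assoc, integral_const_mul]
    rw [← modulus_smul_integral_mul_right hs s, smul_eq_mul, ← mul_assoc, modulus_inv,
      inv_mul_cancel₀ (modulus_pos s).ne', one_mul]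
    simp only [mul_inv_cancel_right]
  have h_le (r : G) : ‖f r‖ * ω (r * s) ≤ ω s * (‖f r‖ * ω r) :=
    (mul_le_mul_of_nonneg_left (ω.submul' r s) (norm_nonneg _)).trans_eq (by ring)
  calc ‖toWCc μ α ω (translateRight s f)‖ = ∫ r, ‖f r‖ * ω (r * s) ∂μ := h_change
    _ ≤ ∫ r, ω s * (‖f r‖ * ω r) ∂μ :=
        integral_mono_of_nonneg
          (Eventually.of_forall fun r => mul_nonneg (norm_nonneg _) (ω.nonneg' _))
          ((toWCc μ α ω f).integrable.const_mul _) (Eventually.of_forall h_le)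
    _ = ω s * ‖toWCc μ α ω f‖ := integral_const_mul _ _

theorem tendsto_translateRight (f : C_c(G, A)) (s : G) :
    Tendsto (fun t => toWCc μ α ω (translateRight t f)) (𝓝 s)
      (𝓝 (toWCc μ α ω (translateRight s f))) := by
  obtain ⟨N, hN, hsN⟩ := exists_compact_mem_nhds s
  have h_zero : ∀ t ∈ N, ∀ r ∉ tsupport f * N, translateRight t f r = 0 := by
    intro t ht r hr
    have h_notMem : r * t⁻¹ ∉ tsupport f := fun h => hr ⟨_, h, t, ht, inv_mul_cancel_right r t⟩
    rw [translateRight_apply, image_eq_zero_of_notMem_tsupport h_notMem, smul_zero]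
  have h_cont : Continuous (Function.uncurry fun t r => translateRight t f r) :=
    (continuous_modulus_inv.comp continuous_fst).smul
      (f.continuous.comp (continuous_snd.mul continuous_fst.inv))
  have hK := f.hasCompactSupport.isCompact.mul hN
  exact tendsto_toWCc hK (h_zero s (mem_of_mem_nhds hsN))
    (mem_of_superset hsN h_zero) (tendstoUniformlyOn_of_continuous_uncurry h_cont hK s)

end Multipliers

section MultiplierOperators

variable {𝕜 G A : Type*} [RCLike 𝕜] [Group G] [TopologicalSpace G] [IsTopologicalGroup G]
  [LocallyCompactSpace G] [MeasurableSpace G] [BorelSpace G] [NonUnitalNormedRing A]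
  [NormedSpace 𝕜 A] (μ : Measure G) [μ.IsHaarMeasure] (α : BddDynSystem 𝕜 G A) (ω : Weight G)

/-- `mulRight` as a bounded bilinear map for the weighted norm. -/
def mulRightL [IsScalarTower 𝕜 A A] [SMulCommClass 𝕜 A A] :
    A →L[𝕜] WCc μ α ω →L[𝕜] WCc μ α ω :=
  LinearMap.mkContinuousOfExistsBound₂
    (LinearMap.mk₂ 𝕜 (fun a (f : WCc μ α ω) => toWCc μ α ω (mulRight α a f))
      (fun a b f => DFunLike.ext _ _ fun r =>
        (congrArg (f r * ·) (map_add (α r) a b)).trans (mul_add (f r) _ _))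
      (fun c a f => DFunLike.ext _ _ fun r =>
        (congrArg (f r * ·) (map_smul (α r) c a)).trans (mul_smul_comm c (f r) _))
      (fun a f g => DFunLike.ext _ _ fun r => add_mul (f r) (g r) _)
      (fun c a f => DFunLike.ext _ _ fun r => smul_mul_assoc c (f r) _))
    (by
      obtain ⟨C, hC⟩ := α.bdd'
      exact ⟨C, fun a f => norm_mulRight_le hC a f⟩)

variable {μ α ω} in
theorem mulRightL_mul [IsScalarTower 𝕜 A A] [SMulCommClass 𝕜 A A] (a b : A) :
    mulRightL μ α ω (a * b) = mulRightL μ α ω b * mulRightL μ α ω a :=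
  ContinuousLinearMap.ext fun f => DFunLike.ext _ _ fun r =>
    (congrArg (f r * ·) (α.map_mul' r a b)).trans (mul_assoc _ _ _).symm

variable [NormedSpace ℝ A]

/-- `translateRight s` as a bounded operator for the weighted norm. -/
def translateRightL [IsScalarTower ℝ 𝕜 A] (s : G) : WCc μ α ω →L[𝕜] WCc μ α ω :=
  LinearMap.mkContinuousOfExistsBound
    { toFun := fun f => toWCc μ α ω (translateRight s f)
      map_add' := fun f g => DFunLike.ext _ _ fun _ => smul_add _ (f _) (g _)
      map_smul' := fun c f => DFunLike.ext _ _ fun _ => smul_comm (modulus s⁻¹) c (f _) }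
    ⟨ω s, norm_translateRight_le s⟩

variable {μ α ω}

theorem norm_translateRightL_le [IsScalarTower ℝ 𝕜 A] (s : G) : ‖translateRightL μ α ω s‖ ≤ ω s :=
  ContinuousLinearMap.opNorm_le_bound _ (ω.nonneg' s) (norm_translateRight_le s)

theorem translateRightL_one [IsScalarTower ℝ 𝕜 A] : translateRightL μ α ω 1 = 1 :=
  ContinuousLinearMap.ext fun f => DFunLike.ext _ _ fun r => by
    change modulus 1⁻¹ • f (r * 1⁻¹) = f r
    rw [inv_one, modulus_one, one_smul, mul_one]

theorem translateRightL_mul [IsScalarTower ℝ 𝕜 A] (s t : G) :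
    translateRightL μ α ω (s * t) = translateRightL μ α ω t * translateRightL μ α ω s :=
  ContinuousLinearMap.ext fun f => DFunLike.ext _ _ fun r => by
    change modulus (s * t)⁻¹ • f (r * (s * t)⁻¹) = modulus t⁻¹ • modulus s⁻¹ • f (r * t⁻¹ * s⁻¹)
    rw [mul_inv_rev, modulus_mul, smul_smul, mul_assoc]

variable [IsScalarTower 𝕜 A A] [SMulCommClass 𝕜 A A] [IsScalarTower ℝ 𝕜 A]

theorem translateRightL_mul_mulRightL (s : G) (a : A) :
    translateRightL μ α ω s * mulRightL μ α ω (α s a) =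
      mulRightL μ α ω a * translateRightL μ α ω s :=
  ContinuousLinearMap.ext fun f => DFunLike.ext _ _ fun r => by
    change modulus s⁻¹ • (f (r * s⁻¹) * α (r * s⁻¹) (α s a)) = modulus s⁻¹ • f (r * s⁻¹) * α r a
    have h_hom : α (r * s⁻¹) (α s a) = α r a := by
      change (α.toHom (r * s⁻¹) * α.toHom s) a = α.toHom r a
      rw [← map_mul, inv_mul_cancel_right]
    rw [h_hom]
    exact ((ContinuousLinearMap.mul 𝕜 A).flip (α r a)).map_smul_of_tower _ _ |>.symm

theorem translateRightL_convL (t : G) (f g : WCc μ α ω) :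
    translateRightL μ α ω t (convL μ α ω f g) = convL μ α ω f (translateRightL μ α ω t g) :=
  DFunLike.ext _ _ fun s => by
    refine (integral_smul (modulus t⁻¹) _).symm.trans
      (integral_congr_ae (Eventually.of_forall fun r => ?_))
    change modulus t⁻¹ • (f r * α r (g (r⁻¹ * (s * t⁻¹)))) =
      f r * α r (modulus t⁻¹ • g (r⁻¹ * s * t⁻¹))
    rw [(α r).map_smul_of_tower, mul_assoc]
    exact ((ContinuousLinearMap.mul 𝕜 A (f r)).map_smul_of_tower _ _).symm

theorem mulRightL_convL [CompleteSpace A] (a : A) (f g : WCc μ α ω) :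
    mulRightL μ α ω a (convL μ α ω f g) = convL μ α ω f (mulRightL μ α ω a g) :=
  DFunLike.ext _ _ fun s => by
    have h_hom (r : G) : α r (α (r⁻¹ * s) a) = α s a := by
      change (α.toHom r * α.toHom (r⁻¹ * s)) a = α.toHom s a
      rw [← map_mul, mul_inv_cancel_left]
    have h_int := ((ContinuousLinearMap.mul 𝕜 A).flip (α s a)).integral_comp_comm
      (conv_integrable μ α f g s)
    refine h_int.symm.trans (integral_congr_ae (Eventually.of_forall fun r => ?_))
    change f r * α r (g (r⁻¹ * s)) * α s a = f r * α r (g (r⁻¹ * s) * α (r⁻¹ * s) a)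
    rw [α.map_mul', h_hom, mul_assoc]

end MultiplierOperators

section ApproximateIdentity

theorem IsBddApproxRightId.tendstoUniformlyOn {A I : Type*} [NonUnitalNormedRing A] [Preorder I]
    {u : I → A} (hu : IsBddApproxRightId u) {B : Set A} (hB : IsCompact B) :
    TendstoUniformlyOn (fun i b => b * u i) id atTop B := by
  obtain ⟨M, hM⟩ := hu.bdd
  have h_lipschitz (i : I) : LipschitzWith M.toNNReal fun b => b * u i :=
    LipschitzWith.of_dist_le_mul fun b c => by
      rw [dist_eq_norm, dist_eq_norm, ← sub_mul, mul_comm (M.toNNReal : ℝ)]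
      exact norm_mul_le_of_le le_rfl ((hM i).trans (Real.le_coe_toNNReal M))
  have h_cover : ⋃₀ {K : Set A | IsCompact K} = Set.univ :=
    Set.eq_univ_of_forall fun a => ⟨{a}, isCompact_singleton, rfl⟩
  have h_equicont := (LipschitzWith.uniformEquicontinuous _ _ h_lipschitz).equicontinuous
  exact UniformOnFun.tendsto_iff_tendstoUniformlyOn.1
    ((EquicontinuousOn.tendsto_uniformOnFun_iff_pi (fun _ hK => hK) h_cover
      (fun K _ => h_equicont.equicontinuousOn K) atTop id).2 (tendsto_pi_nhds.2 hu.tendsto)) B hB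

section MulRight

variable {𝕜 G A I : Type*} [RCLike 𝕜] [Group G] [TopologicalSpace G] [IsTopologicalGroup G]
  [NonUnitalNormedRing A] [NormedSpace 𝕜 A] {α : BddDynSystem 𝕜 G A} [Preorder I] {u : I → A}

theorem IsBddApproxRightId.tendstoUniformly_mulRight (hu : IsBddApproxRightId u)
    (f : C_c(G, A)) : TendstoUniformly (fun i r => mulRight α (u i) f r) f atTop := by
  obtain ⟨C, hC⟩ := α.bdd'
  have hB : IsCompact (Set.range fun r => α r⁻¹ (f r)) := by
    refine HasCompactSupport.isCompact_range (f.hasCompactSupport.mono fun r hr h0 => hr ?_)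
      (α.continuous_uncurry.comp (continuous_inv.prodMk f.continuous))
    exact (congrArg (α r⁻¹) h0).trans (map_zero _)
  refine Metric.tendstoUniformly_iff.2 fun ε hε => ?_
  obtain ⟨δ, hδ, hCδ⟩ := exists_pos_mul_lt hε C
  filter_upwards [Metric.tendstoUniformlyOn_iff.1 (hu.tendstoUniformlyOn hB) δ hδ] with i hi r
  have h_eq : f r - mulRight α (u i) f r = α r (α r⁻¹ (f r) - α r⁻¹ (f r) * u i) := by
    have h_inv := α.inv_apply_apply r⁻¹ (f r)
    rw [inv_inv] at h_inv
    rw [mulRight_apply_eq_apply_mul, map_sub, h_inv]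
  rw [dist_eq_norm, h_eq]
  refine ((α r).le_of_opNorm_le_of_le (hC r) ?_).trans_lt hCδ
  exact (dist_eq_norm _ _).symm.trans_le (hi _ ⟨r, rfl⟩).le

theorem IsBddApproxRightId.tendsto_toWCc_mulRight [LocallyCompactSpace G] [MeasurableSpace G]
    [BorelSpace G] {μ : Measure G} [μ.IsHaarMeasure] {ω : Weight G} (hu : IsBddApproxRightId u)
    (f : C_c(G, A)) :
    Tendsto (fun i => toWCc μ α ω (mulRight α (u i) f)) atTop (𝓝 (toWCc μ α ω f)) := by
  have h_zero : ∀ r ∉ tsupport f, f r = 0 := fun r hr => image_eq_zero_of_notMem_tsupport hr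
  refine tendsto_toWCc f.hasCompactSupport.isCompact h_zero (Eventually.of_forall fun i r hr => ?_)
    (hu.tendstoUniformly_mulRight f).tendstoUniformlyOn
  rw [mulRight_apply, h_zero r hr, zero_mul]

end MulRight

section ConvTensor

variable {𝕜 G A : Type*} [RCLike 𝕜] [Group G] [TopologicalSpace G] [IsTopologicalGroup G]
  [MeasurableSpace G] [BorelSpace G] {μ : Measure G} [μ.IsHaarMeasure]
  [NonUnitalNormedRing A] [NormedSpace 𝕜 A] [NormedSpace ℝ A] {α : BddDynSystem 𝕜 G A}

theorem conv_tensor_apply [IsScalarTower 𝕜 A A] [SMulCommClass 𝕜 A A] [IsScalarTower ℝ 𝕜 A]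
    (f : C_c(G, A)) (z : C_c(G, ℝ)) (a : A) (s : G) :
    conv μ α f (tensor z a) s = ∫ t, z t⁻¹ • mulRight α a f (s * t) ∂μ := by
  rw [conv_apply, ← integral_mul_left_eq_self _ s]
  refine integral_congr_ae (Eventually.of_forall fun t => ?_)
  change f (s * t) * α (s * t) (z ((s * t)⁻¹ * s) • a) = z t⁻¹ • (f (s * t) * α (s * t) a)
  rw [mul_inv_rev, inv_mul_cancel_right, (α (s * t)).map_smul_of_tower]
  exact (ContinuousLinearMap.mul 𝕜 A (f (s * t))).map_smul_of_tower _ _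

theorem conv_tensor_eq_zero {f : C_c(G, A)} {z : C_c(G, ℝ)} {a : A} {L : Set G}
    (hz : Function.support z ⊆ L) {s : G} (hs : s ∉ tsupport f * L) :
    conv μ α f (tensor z a) s = 0 := by
  rw [conv_apply]
  refine integral_eq_zero_of_ae (Eventually.of_forall fun r => ?_)
  by_contra h
  obtain ⟨hr, hrs⟩ := conv_support α f (tensor z a) s r h
  exact hs ⟨r, subset_tsupport _ hr, r⁻¹ * s, hz (left_ne_zero_of_smul hrs),
    mul_inv_cancel_left r s⟩

end ConvTensor

section Bump

variable {𝕜 G A : Type*} [RCLike 𝕜] [Group G] [TopologicalSpace G] [IsTopologicalGroup G]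
  [LocallyCompactSpace G] [MeasurableSpace G] [BorelSpace G] {μ : Measure G} [μ.IsHaarMeasure]
  [NonUnitalNormedRing A] [NormedSpace 𝕜 A] {α : BddDynSystem 𝕜 G A} {ω : Weight G}
  {𝒵 : Set (Set G)} {z : 𝒵 → C_c(G, ℝ)}

theorem IsBumpFamily.exists_integral_mul_weight_le (hz : IsBumpFamily μ 𝒵 z)
    (h𝒵 : IsCompactNhdBase 𝒵) (ω : Weight G) : ∃ c, ∀ V, ∫ r, z V r * ω r ∂μ ≤ c := by
  obtain ⟨L, hL, h𝒵L⟩ := h𝒵.compact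
  obtain ⟨D, hD⟩ := ω.bddOn_compact hL
  obtain ⟨D', hD'⟩ := hL.exists_bound_of_continuousOn (continuous_modulus (G := G)).continuousOn
  have h_int (V : 𝒵) : Integrable (fun r => modulus r⁻¹ * z V r) μ :=
    (continuous_modulus_inv.mul (z V).continuous).integrable_of_hasCompactSupport
      (z V).hasCompactSupport.mul_left
  have h_le (V : 𝒵) (r : G) : z V r * ω r ≤ D' * D * (modulus r⁻¹ * z V r) := by
    by_cases hr : z V r = 0
    · simp only [hr, zero_mul, mul_zero, le_refl]
    have hrL : r ∈ L := h𝒵L V V.2 (hz.supp V hr)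
    have h_modulus : modulus r ≤ D' := (le_abs_self _).trans (hD' r hrL)
    calc z V r * ω r = modulus r * ω r * (modulus r⁻¹ * z V r) := by
          rw [modulus_inv]
          field_simp [(modulus_pos r).ne']
      _ ≤ D' * D * (modulus r⁻¹ * z V r) :=
          mul_le_mul_of_nonneg_right
            (mul_le_mul h_modulus (hD r hrL) (ω.nonneg' r) ((modulus_pos r).le.trans h_modulus))
            (mul_nonneg (modulus_pos _).le (hz.nonneg V r))
  refine ⟨D' * D, fun V => ?_⟩
  calc ∫ r, z V r * ω r ∂μ ≤ ∫ r, D' * D * (modulus r⁻¹ * z V r) ∂μ :=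
        integral_mono (integrable_mul_weight μ ω _ (z V).continuous (z V).hasCompactSupport)
          ((h_int V).const_mul _) (h_le V)
    _ = D' * D := by rw [integral_const_mul, hz.integral_modulus V, mul_one]

variable [NormedSpace ℝ A]

theorem norm_toWCc_tensor {z : C_c(G, ℝ)} (hz : ∀ r, 0 ≤ z r) (a : A) :
    ‖toWCc μ α ω (tensor z a)‖ = ‖a‖ * ∫ r, z r * ω r ∂μ := by
  rw [WCc.norm_def, ← integral_const_mul]
  refine integral_congr_ae (Eventually.of_forall fun r => ?_)
  change ‖z r • a‖ * ω r = ‖a‖ * (z r * ω r)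
  rw [norm_smul, Real.norm_of_nonneg (hz r)]
  ring

variable [IsScalarTower 𝕜 A A] [SMulCommClass 𝕜 A A] [IsScalarTower ℝ 𝕜 A]

theorem tendsto_conv_tensor [CompleteSpace A] (h𝒵 : IsCompactNhdBase 𝒵)
    (hz : IsBumpFamily μ 𝒵 z) {I : Type*} [Preorder I] {u : I → A} (hu : IsBddApproxRightId u)
    (f : C_c(G, A)) :
    Tendsto (fun p : (↥𝒵)ᵒᵈ × I =>
        toWCc μ α ω (conv μ α f (tensor (z (OrderDual.ofDual p.1)) (u p.2))))
      (atTop ×ˢ atTop) (𝓝 (toWCc μ α ω f)) := by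
  obtain ⟨L, hL, h𝒵L⟩ := h𝒵.compact
  have hf := f.hasCompactSupport.isCompact
  have hK : IsCompact (tsupport f ∪ tsupport f * L) := hf.union (hf.mul hL)
  refine tendsto_toWCc hK (fun r hr => image_eq_zero_of_notMem_tsupport fun h => hr (Or.inl h))
    (Eventually.of_forall fun p r hr => conv_tensor_eq_zero ((hz.supp _).trans
      (h𝒵L _ (Subtype.coe_prop _))) fun h => hr (Or.inr h))
    (Metric.tendstoUniformlyOn_iff.2 fun ε hε => ?_)
  have h_translate := Metric.tendstoUniformlyOn_iff.1 (tendstoUniformlyOn_of_continuous_uncurry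
    (F := fun t s => f (s * t⁻¹))
    (f.continuous.comp (continuous_snd.mul continuous_fst.inv)) hK 1) (ε / 3) (by positivity)
  have h_mulRight := Metric.tendstoUniformly_iff.1 (hu.tendstoUniformly_mulRight (α := α) f)
    (ε / 3) (by positivity)
  filter_upwards [(h𝒵.eventually_subset h_translate).prod_mk h_mulRight] with p ⟨hV, hi⟩ s hs
  rw [dist_comm, dist_eq_norm, conv_tensor_apply]
  refine (norm_integral_smul_sub_le (ε := ε / 3 + ε / 3) ((z _).continuous.comp continuous_inv)
    ((z _).hasCompactSupport.comp_homeomorph (Homeomorph.inv G)) (fun r => hz.nonneg _ _)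
    (hz.integral_inv _) ((mulRight α (u p.2) f).continuous.comp (continuous_const_mul s))
    fun t ht => ?_).trans_lt (by linarith)
  have h_near := hV (hz.supp _ ht) s hs
  simp only [inv_inv, inv_one, mul_one] at h_near
  rw [← dist_eq_norm]
  exact (dist_triangle_left _ _ (f (s * t))).trans
    (add_le_add (hi (s * t)).le ((dist_comm _ _).trans_le h_near.le))

end Bump

end ApproximateIdentity

section Implements

variable {𝕜 E X : Type*} [RCLike 𝕜] [SeminormedAddCommGroup E] [NormedSpace 𝕜 E]
  [NormedAddCommGroup X] [NormedSpace 𝕜 X]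

/-- The operator `S` on `X` implements the operator `R` on `E` through the representation `τ` of
`E` on `X`: `S (τ(f) x) = τ(R f) x`. When `τ` is non-degenerate there is at most one such `S`. -/
def Implements (τ : E →L[𝕜] X →L[𝕜] X) (R : E →L[𝕜] E) (S : X →L[𝕜] X) : Prop :=
  ∀ f x, S (τ f x) = τ (R f) x

namespace Implements

variable {τ : E →L[𝕜] X →L[𝕜] X} {R R' : E →L[𝕜] E} {S S' : X →L[𝕜] X}

theorem unique (hτ : NonDegenerate τ) (h : Implements τ R S) (h' : Implements τ R S') : S = S' :=
  hτ.ext fun f x => (h f x).trans (h' f x).symm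

theorem one : Implements τ 1 1 := fun _ _ => rfl

theorem add (h : Implements τ R S) (h' : Implements τ R' S') :
    Implements τ (R + R') (S + S') := fun f x => by
  rw [add_apply, add_apply, map_add, add_apply, h, h']

theorem smul (h : Implements τ R S) (c : 𝕜) : Implements τ (c • R) (c • S) := fun f x => by
  rw [smul_apply, smul_apply, map_smul, smul_apply, h]

theorem mul (h : Implements τ R S) (h' : Implements τ R' S') :
    Implements τ (R * R') (S * S') := fun f x => by
  rw [mul_apply_eq_comp, mul_apply_eq_comp, h', h]

theorem exists_of_approxId [CompleteSpace X] (hτ : NonDegenerate τ) {m : E → E → E}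
    (hm : ∀ f g x, τ (m f g) x = τ g (τ f x)) {I : Type*} {l : Filter I} [l.NeBot] {e : I → E}
    {M : ℝ} (he : ∀ i, ‖e i‖ ≤ M) (hme : ∀ f, Tendsto (fun i => m f (e i)) l (𝓝 f))
    (hR : ∀ f g, R (m f g) = m f (R g)) : ∃ S, Implements τ R S ∧ ‖S‖ ≤ ‖τ‖ * (‖R‖ * M) := by
  have h_lim (f : E) (x : X) : Tendsto (fun i => τ (R (e i)) (τ f x)) l (𝓝 (τ (R f) x)) := by
    simp only [← hm, ← hR]
    exact (((τ.continuous.comp R.continuous).clm_apply continuous_const).tendsto f).comp (hme f)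
  obtain ⟨S, hS, hS_norm⟩ := exists_strong_limit (S := fun i => τ (R (e i)))
    (fun i => τ.le_of_opNorm_le_of_le le_rfl (R.le_of_opNorm_le_of_le le_rfl (he i))) hτ
    (by rintro _ ⟨f, x, rfl⟩; exact ⟨_, h_lim f x⟩)
  exact ⟨S, fun f x => tendsto_nhds_unique (hS _) (h_lim f x), hS_norm⟩

theorem exists_continuousLinearMap (hτ : NonDegenerate τ) {F : Type*} [SeminormedAddCommGroup F]
    [NormedSpace 𝕜 F] (Q : F →L[𝕜] E →L[𝕜] E) {M : ℝ} (hM : 0 ≤ M)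
    (h : ∀ a, ∃ S, Implements τ (Q a) S ∧ ‖S‖ ≤ M * ‖Q a‖) :
    ∃ π : F →L[𝕜] X →L[𝕜] X, ∀ a, Implements τ (Q a) (π a) := by
  choose S hS hS_norm using h
  refine ⟨LinearMap.mkContinuous
    { toFun := S
      map_add' := fun a b => unique hτ (hS (a + b)) (by rw [map_add]; exact (hS a).add (hS b))
      map_smul' := fun c a => unique hτ (hS (c • a)) (by rw [map_smul]; exact (hS a).smul c) }
    (M * ‖Q‖) fun a => ?_, hS⟩
  rw [mul_assoc]
  exact (hS_norm a).trans (mul_le_mul_of_nonneg_left (Q.le_opNorm a) hM)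

theorem continuous_apply (hτ : NonDegenerate τ) {Y : Type*} [TopologicalSpace Y]
    {Q : Y → E →L[𝕜] E} {U : Y → X →L[𝕜] X} (h : ∀ s, Implements τ (Q s) (U s))
    (hQ : ∀ f, Continuous fun s => Q s f) (hU : ∀ s, ∃ D, ∀ᶠ t in 𝓝 s, ‖U t‖ ≤ D) (x : X) :
    Continuous fun s => U s x := by
  refine continuous_iff_continuousAt.2 fun s => ?_
  obtain ⟨D, hD⟩ := hU s
  refine hτ.tendsto hD (fun f y => ?_) x
  simp only [h _ f y]
  exact ((τ.continuous.comp (hQ f)).clm_apply continuous_const).tendsto s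

end Implements

end Implements

section Disintegration

variable {𝕜 G A X : Type*} [RCLike 𝕜] [Group G] [TopologicalSpace G] [IsTopologicalGroup G]
  [LocallyCompactSpace G] [MeasurableSpace G] [BorelSpace G] {μ : Measure G} [μ.IsHaarMeasure]
  [NonUnitalNormedRing A] [NormedSpace 𝕜 A] [IsScalarTower 𝕜 A A] [SMulCommClass 𝕜 A A]
  [NormedAddCommGroup X] [NormedSpace 𝕜 X] {α : BddDynSystem 𝕜 G A} {ω : Weight G}
  {τ : WCc μ α ω →L[𝕜] X →L[𝕜] X}

theorem nonDegenerate_of_implements_mulRightL (hτ : NonDegenerate τ) {J : Type*} [Preorder J]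
    [IsDirected J (· ≤ ·)] [Nonempty J] {v : J → A} (hv : IsBddApproxRightId v)
    {π : A →L[𝕜] X →L[𝕜] X} (hπ : ∀ a, Implements τ (mulRightL μ α ω a) (π a)) :
    NonDegenerate π :=
  hτ.of_forall_mem_closure fun f x => by
    refine mem_closure_of_tendsto (b := atTop) (((τ.flip x).continuous.tendsto f).comp
      (hv.tendsto_toWCc_mulRight f)) (Eventually.of_forall fun i => ?_)
    exact Submodule.subset_span ⟨v i, τ f x, hπ (v i) f x⟩

variable [NormedSpace ℝ A] [IsScalarTower ℝ 𝕜 A]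

/-- The pair `(π, U)` obtained from a non-degenerate `τ` when `π(a)` implements right
multiplication by `a` and `U_s` implements right translation by `s`. -/
def AAPair.ofImplements (hτ : NonDegenerate τ) {π : A →L[𝕜] X →L[𝕜] X} {U : G → X →L[𝕜] X}
    (hπ_nondeg : NonDegenerate π) (hπ : ∀ a, Implements τ (mulRightL μ α ω a) (π a))
    (hU : ∀ s, Implements τ (translateRightL μ α ω s) (U s)) {C : ℝ} (hC : 0 ≤ C)
    (hUC : ∀ s, ‖U s‖ ≤ C * ω s) : AAPair α ω X where
  π := π
  U := U
  π_mul a b := (hπ (a * b)).unique hτ (by rw [mulRightL_mul]; exact (hπ b).mul (hπ a))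
  π_nondeg := hπ_nondeg
  U_one := (hU 1).unique hτ (by rw [translateRightL_one]; exact .one)
  U_mul r s := (hU (r * s)).unique hτ (by rw [translateRightL_mul]; exact (hU s).mul (hU r))
  U_cont := Implements.continuous_apply hτ hU
    (fun f => continuous_iff_continuousAt.2 (tendsto_translateRight f)) fun s => by
      obtain ⟨D, hD⟩ := ω.exists_eventually_le s
      exact ⟨C * D, hD.mono fun t ht => (hUC t).trans (mul_le_mul_of_nonneg_left ht hC)⟩
  covariant r a := by
    have h_comm : translateRightL μ α ω r * mulRightL μ α ω a * translateRightL μ α ω r⁻¹ =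
        mulRightL μ α ω (α r⁻¹ a) := by
      have h_inv := α.inv_apply_apply r⁻¹ a
      have h := translateRightL_mul_mulRightL (μ := μ) (α := α) (ω := ω) r (α r⁻¹ a)
      rw [inv_inv] at h_inv
      rw [h_inv] at h
      rw [h, mul_assoc, ← translateRightL_mul, inv_mul_cancel, translateRightL_one, mul_one]
    exact (((hU r).mul (hπ a)).mul (hU r⁻¹)).unique hτ (h_comm ▸ hπ (α r⁻¹ a))
  U_bdd := ⟨C, hUC⟩

end Disintegration

theorem continuous_toBoundedContinuousFunction {Q Y E : Type*} [TopologicalSpace Q]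
    [TopologicalSpace Y] [NormedAddCommGroup E] {H : Q → C_c(Y, E)}
    (hH : Continuous fun p : Q × Y => H p.1 p.2) {L : Set Y} (hL : IsCompact L)
    (hHL : ∀ q, ∀ y ∉ L, H q y = 0) :
    Continuous fun q => (H q).toBoundedContinuousFunction := by
  refine continuous_iff_continuousAt.2 fun q =>
    BoundedContinuousFunction.tendsto_iff_tendstoUniformly.2 <|
      Metric.tendstoUniformly_iff.2 fun ε hε => ?_
  filter_upwards [Metric.tendstoUniformlyOn_iff.1
    (tendstoUniformlyOn_of_continuous_uncurry (F := fun q y => H q y) hH hL q) ε hε] with r hr y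
  by_cases hy : y ∈ L
  · exact hr y hy
  · change dist (H q y) (H r y) < ε
    rwa [hHL q y hy, hHL r y hy, dist_self]

section VectorIntegral

variable {𝕜 G A X : Type*} [RCLike 𝕜] [Group G] [TopologicalSpace G] [IsTopologicalGroup G]
  [LocallyCompactSpace G] [MeasurableSpace G] [BorelSpace G] (μ : Measure G) [μ.IsHaarMeasure]
  [NonUnitalNormedRing A] [NormedSpace 𝕜 A] [NormedSpace ℝ A] [IsScalarTower ℝ 𝕜 A]
  (α : BddDynSystem 𝕜 G A) (ω : Weight G)

/-- Multiplication by `χ ∈ C_c(G)`, from bounded continuous functions to `C_c(G, A)`. It transfers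
Bochner integrals from the complete space of bounded continuous functions to the incomplete space
`C_c(G, A)`. -/
def cutoffL (χ : C_c(G, ℝ)) : BoundedContinuousFunction G A →L[𝕜] WCc μ α ω :=
  LinearMap.mkContinuousOfExistsBound
    { toFun := fun h => toWCc μ α ω
        ⟨⟨fun t => χ t • h t, χ.continuous.smul h.continuous⟩, χ.hasCompactSupport.smul_right⟩
      map_add' := fun f g => DFunLike.ext _ _ fun t => smul_add (χ t) (f t) (g t)
      map_smul' := fun c f => DFunLike.ext _ _ fun t => smul_comm (χ t) c (f t) }
    ⟨∫ r, ‖χ r‖ * ω r ∂μ, fun h => by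
      refine (norm_toWCc_le_of_norm_le (h := fun r => ‖χ r‖ * ‖h‖) (by fun_prop)
        χ.hasCompactSupport.norm.mul_right fun r => ?_).trans_eq ?_
      · exact (norm_smul _ _).trans_le
          (mul_le_mul_of_nonneg_left (h.norm_coe_le_norm r) (norm_nonneg _))
      · rw [← integral_mul_const]
        exact integral_congr_ae (Eventually.of_forall fun r => by ring)⟩

variable {μ α ω}

theorem cutoffL_eq_toWCc {χ : C_c(G, ℝ)} {L : Set G} (hχ : Set.EqOn χ 1 L)
    {h : BoundedContinuousFunction G A} {f : C_c(G, A)} (hf : ∀ t, f t = h t)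
    (hfL : ∀ t ∉ L, f t = 0) : cutoffL μ α ω χ h = toWCc μ α ω f :=
  DFunLike.ext _ _ fun t => by
    change χ t • h t = f t
    by_cases ht : t ∈ L
    · rw [hχ ht, Pi.one_apply, one_smul, hf]
    · rw [← hf, hfL t ht, smul_zero]

variable [CompleteSpace A] [NormedAddCommGroup X] [NormedSpace 𝕜 X] [CompleteSpace X]
  [NormedSpace ℝ X]

theorem integral_apply_toWCc {H : G → C_c(G, A)} (hH : Continuous fun p : G × G => H p.1 p.2)
    {K L : Set G} (hK : IsCompact K) (hL : IsCompact L)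
    (hHK : ∀ r t, H r t ≠ 0 → r ∈ K ∧ t ∈ L) {k : C_c(G, A)} (hk : ∀ t, k t = ∫ r, H r t ∂μ)
    (Ψ : WCc μ α ω →L[𝕜] X) :
    ∫ r, Ψ (toWCc μ α ω (H r)) ∂μ = Ψ (toWCc μ α ω k) := by
  obtain ⟨χ₀, hχ_one, -, hχs, -⟩ :=
    exists_continuous_one_zero_of_isCompact hL isClosed_empty (Set.disjoint_empty L)
  set χ : C_c(G, ℝ) := ⟨χ₀, hχs⟩
  let Hb (r : G) : BoundedContinuousFunction G A := (H r).toBoundedContinuousFunction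
  have hHL (r t : G) (ht : t ∉ L) : H r t = 0 := by_contra fun h => ht (hHK r t h).2
  have h_int : Integrable Hb μ := by
    refine (continuous_toBoundedContinuousFunction hH hL hHL).integrable_of_hasCompactSupport
      (HasCompactSupport.intro hK fun r hr => ?_)
    ext t
    exact by_contra fun h => hr (hHK r t h).1
  have hk_eq (t : G) : k t = (∫ r, Hb r ∂μ) t :=
    (hk t).trans ((BoundedContinuousFunction.evalCLM ℝ t).integral_comp_comm h_int)
  have hkL (t : G) (ht : t ∉ L) : k t = 0 := by simp only [hk, hHL _ t ht, integral_zero]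
  calc ∫ r, Ψ (toWCc μ α ω (H r)) ∂μ = ∫ r, (Ψ.comp (cutoffL μ α ω χ)) (Hb r) ∂μ :=
        integral_congr_ae (Eventually.of_forall fun r =>
          congrArg Ψ (cutoffL_eq_toWCc hχ_one (fun _ => rfl) (hHL r)).symm)
    _ = Ψ (cutoffL μ α ω χ (∫ r, Hb r ∂μ)) := (Ψ.comp (cutoffL μ α ω χ)).integral_comp_comm h_int
    _ = Ψ (toWCc μ α ω k) := congrArg Ψ (cutoffL_eq_toWCc hχ_one hk_eq hkL)

end VectorIntegral

section Convolution

variable {𝕜 G A : Type*} [RCLike 𝕜] [Group G] [TopologicalSpace G] [IsTopologicalGroup G]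
  [LocallyCompactSpace G] [NonUnitalNormedRing A] [NormedSpace 𝕜 A] [NormedSpace ℝ A]
  {α : BddDynSystem 𝕜 G A}

theorem continuous_translateRight_mulRight (f g : C_c(G, A)) :
    Continuous fun p : G × G => translateRight p.1 (mulRight α (f p.1) g) p.2 := by
  borelize G
  exact (continuous_modulus_inv.comp continuous_fst).smul
    ((g.continuous.comp (continuous_snd.mul continuous_fst.inv)).mul
      (α.continuous_uncurry.comp ((continuous_snd.mul continuous_fst.inv).prodMk
        (f.continuous.comp continuous_fst))))

theorem mem_tsupport_of_translateRight_mulRight_ne_zero {f g : C_c(G, A)} {r t : G}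
    (h : translateRight r (mulRight α (f r) g) t ≠ 0) :
    r ∈ tsupport f ∧ t ∈ tsupport g * tsupport f := by
  rw [translateRight_apply, mulRight_apply] at h
  have hr : r ∈ tsupport f := subset_tsupport _ fun h_zero => h (by simp [h_zero])
  have ht : t * r⁻¹ ∈ tsupport g := subset_tsupport _ fun h_zero => h (by simp [h_zero])
  exact ⟨hr, Set.mem_mul.2 ⟨_, ht, r, hr, inv_mul_cancel_right t r⟩⟩

variable [MeasurableSpace G] [BorelSpace G] {μ : Measure G} [μ.IsHaarMeasure] [CompleteSpace A]

theorem conv_eq_integral_translateRight (f g : C_c(G, A)) (t : G) :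
    conv μ α g f t = ∫ r, translateRight r (mulRight α (f r) g) t ∂μ := by
  have h_cont : Continuous fun r => mulRight α (f r) g (t * r⁻¹) :=
    (g.continuous.comp (continuous_const.mul continuous_inv)).mul
      (α.continuous_uncurry.comp ((continuous_const.mul continuous_inv).prodMk f.continuous))
  have h_supp : HasCompactSupport fun r => mulRight α (f r) g (t * r⁻¹) :=
    f.hasCompactSupport.mono fun r hr h_zero => hr (by simp [mulRight_apply, h_zero])
  calc conv μ α g f t = ∫ r, mulRight α (f (r⁻¹ * t)) g r ∂μ := rfl
    _ = ∫ r, mulRight α (f (t⁻¹ * r)⁻¹) g (t * (t⁻¹ * r)⁻¹⁻¹) ∂μ := by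
        simp only [mul_inv_rev, inv_inv, mul_inv_cancel_left]
    _ = ∫ r, mulRight α (f r⁻¹) g (t * r⁻¹⁻¹) ∂μ :=
        integral_mul_left_eq_self (fun r => mulRight α (f r⁻¹) g (t * r⁻¹⁻¹)) t⁻¹
    _ = ∫ r, translateRight r (mulRight α (f r) g) t ∂μ :=
        integral_inv_eq_integral_modulus_inv_smul h_cont h_supp

end Convolution

section IntegratedForm

variable {𝕜 G A X : Type*} [RCLike 𝕜] [Group G] [TopologicalSpace G] [IsTopologicalGroup G]
  [LocallyCompactSpace G] [MeasurableSpace G] [BorelSpace G] {μ : Measure G} [μ.IsHaarMeasure]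
  [NonUnitalNormedRing A] [NormedSpace 𝕜 A] [IsScalarTower 𝕜 A A] [SMulCommClass 𝕜 A A]
  [CompleteSpace A] [NormedSpace ℝ A] [IsScalarTower ℝ 𝕜 A]
  [NormedAddCommGroup X] [NormedSpace 𝕜 X] [CompleteSpace X] [NormedSpace ℝ X]
  [IsScalarTower ℝ 𝕜 X] {α : BddDynSystem 𝕜 G A} {ω : Weight G}

theorem AAPair.integratedCc_eq_of_implements (P : AAPair α ω X)
    {τ : WCc μ α ω →L[𝕜] X →L[𝕜] X} (hτ : NonDegenerate τ)
    (hm : ∀ f g x, τ (convL μ α ω f g) x = τ g (τ f x))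
    (hπ : ∀ a, Implements τ (mulRightL μ α ω a) (P.π a))
    (hU : ∀ s, Implements τ (translateRightL μ α ω s) (P.U s)) : P.integratedCc μ = τ :=
  ContinuousLinearMap.ext fun f => hτ.ext fun g y =>
    calc P.integratedCc μ f (τ g y)
        = ∫ r, τ (toWCc μ α ω (translateRight r (mulRight α (f r) g))) y ∂μ := by
          rw [integratedCc_apply]
          exact integral_congr_ae (Eventually.of_forall fun r =>
            (congrArg (P.U r) (hπ (f r) g y)).trans (hU r _ y))
      _ = τ (toWCc μ α ω (conv μ α g f)) y :=
          integral_apply_toWCc (continuous_translateRight_mulRight f g)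
            f.hasCompactSupport.isCompact
            (g.hasCompactSupport.isCompact.mul f.hasCompactSupport.isCompact)
            (fun _ _ => mem_tsupport_of_translateRight_mulRight_ne_zero)
            (conv_eq_integral_translateRight f g) ((ContinuousLinearMap.apply 𝕜 X y).comp τ)
      _ = τ f (τ g y) := hm g f y

end IntegratedForm

namespace AntiRep

variable {𝕜 G A X : Type*} [RCLike 𝕜] [Group G] [TopologicalSpace G] [IsTopologicalGroup G]
  [LocallyCompactSpace G] [MeasurableSpace G] [BorelSpace G] {μ : Measure G} [μ.IsHaarMeasure]
  [NonUnitalNormedRing A] [NormedSpace 𝕜 A] [IsScalarTower 𝕜 A A] [SMulCommClass 𝕜 A A]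
  [NormedSpace ℝ A] [IsScalarTower ℝ 𝕜 A]
  [NormedAddCommGroup X] [NormedSpace 𝕜 X] {α : BddDynSystem 𝕜 G A} {ω : Weight G}
  (T : AntiRep μ α ω X)

/-- The restriction of an anti-representation of `L¹(G, A, ω; α)` to `C_c(G, A)`. -/
def onCc : WCc μ α ω →L[𝕜] X →L[𝕜] X :=
  T.T.comp UniformSpace.Completion.toComplL

theorem ext_onCc {T T' : AntiRep μ α ω X} (h : T.onCc = T'.onCc) : T = T' := by
  have h_eq : T.T = T'.T := ContinuousLinearMap.ext fun b =>
    denseRange_toL1.induction_on b (isClosed_eq T.T.continuous T'.T.continuous) fun f =>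
      congrArg (fun τ : WCc μ α ω →L[𝕜] X →L[𝕜] X => τ (toWCc μ α ω f)) h
  cases T
  cases T'
  congr

theorem nonDegenerate_onCc : NonDegenerate T.onCc :=
  T.T_nondeg.of_forall_mem_closure fun b x =>
    denseRange_toL1.induction_on b
      (isClosed_closure.preimage (T.T.continuous.clm_apply continuous_const)) fun f =>
      subset_closure (Submodule.subset_span ⟨toWCc μ α ω f, x, rfl⟩)

theorem onCc_convL (f g : WCc μ α ω) (x : X) :
    T.onCc (convL μ α ω f g) x = T.onCc g (T.onCc f x) :=
  DFunLike.congr_fun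
    ((congrArg T.T (GenBeurling.toL1_mul μ α ω f g).symm).trans (T.T_mul _ _)) x

variable [CompleteSpace A] [CompleteSpace X]
  {J : Type*} [Preorder J] [IsDirected J (· ≤ ·)] [Nonempty J]
  {v : J → A}

theorem exists_forall_implements (hv : IsBddApproxRightId v) :
    ∃ M : ℝ, 0 ≤ M ∧ ∀ R : WCc μ α ω →L[𝕜] WCc μ α ω,
      (∀ f g, R (convL μ α ω f g) = convL μ α ω f (R g)) →
        ∃ S, Implements T.onCc R S ∧ ‖S‖ ≤ M * ‖R‖ := by
  obtain ⟨𝒵, h𝒵⟩ := exists_isCompactNhdBase G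
  obtain ⟨z, hz⟩ := exists_isBumpFamily μ h𝒵
  have := h𝒵.neBot
  obtain ⟨c, hc⟩ := hz.exists_integral_mul_weight_le h𝒵 ω
  obtain ⟨M, hM⟩ := hv.bdd
  have he (p : (↥𝒵)ᵒᵈ × J) :
      ‖toWCc μ α ω (tensor (z (OrderDual.ofDual p.1)) (v p.2))‖ ≤ |M| * |c| := by
    rw [norm_toWCc_tensor (hz.nonneg _)]
    exact mul_le_mul ((hM _).trans (le_abs_self M)) ((hc _).trans (le_abs_self c))
      (integral_nonneg fun r => mul_nonneg (hz.nonneg _ r) (ω.nonneg' r)) (abs_nonneg M)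
  refine ⟨‖T.onCc‖ * (|M| * |c|), by positivity, fun R hR => ?_⟩
  obtain ⟨S, hS, hS_norm⟩ := Implements.exists_of_approxId T.nonDegenerate_onCc
    (m := fun f g => convL μ α ω f g) T.onCc_convL he (tendsto_conv_tensor h𝒵 hz hv) hR
  exact ⟨S, hS, hS_norm.trans_eq (by ring)⟩

variable [NormedSpace ℝ X] [IsScalarTower ℝ 𝕜 X]

theorem exists_toAntiRep_eq (hv : IsBddApproxRightId v) :
    ∃ P : AAPair α ω X, P.toAntiRep μ = T := by
  obtain ⟨M, hM_nonneg, hM⟩ := T.exists_forall_implements hv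
  have hτ := T.nonDegenerate_onCc
  obtain ⟨π, hπ⟩ := Implements.exists_continuousLinearMap hτ (mulRightL μ α ω) hM_nonneg
    fun a => hM _ (mulRightL_convL a)
  choose U hU hU_norm using fun s => hM (translateRightL μ α ω s) (translateRightL_convL s)
  let P : AAPair α ω X := .ofImplements hτ (nonDegenerate_of_implements_mulRightL hτ hv hπ) hπ hU
    hM_nonneg fun s =>
      (hU_norm s).trans (mul_le_mul_of_nonneg_left (norm_translateRightL_le s) hM_nonneg)
  refine ⟨P, ext_onCc ?_⟩
  calc (P.toAntiRep μ).onCc = P.integratedCc μ :=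
        ContinuousLinearMap.ext fun f => P.integrated_toL1 μ f
    _ = T.onCc := P.integratedCc_eq_of_implements hτ T.onCc_convL hπ hU

end AntiRep

section Bounds

variable {𝕜 G A : Type*} [RCLike 𝕜] [Group G] [TopologicalSpace G] [IsTopologicalGroup G]
  [LocallyCompactSpace G] [MeasurableSpace G] [BorelSpace G] {μ : Measure G} [μ.IsHaarMeasure]
  [NonUnitalNormedRing A] [NormedSpace 𝕜 A] [NormedSpace ℝ A] [IsScalarTower ℝ 𝕜 A]
  {α : BddDynSystem 𝕜 G A} {ω : Weight G}

theorem norm_toWCc_check_tensor_le {z : C_c(G, ℝ)} (hz : ∀ r, 0 ≤ z r) (s : G) (b : A) {w : ℝ}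
    (hw : ∀ r, z r ≠ 0 → ω (r * s) ≤ w) :
    ‖toWCc μ α ω (check α (tensor (transR z s) b))‖ ≤
      w * ∫ r, (modulus r⁻¹ * z r) • ‖α (r * s) b‖ ∂μ := by
  have h_supp : HasCompactSupport fun r => z (r * s⁻¹) * ‖α r b‖ :=
    (transR z s).hasCompactSupport.mul_right
  have h_int : Integrable (fun r => modulus r⁻¹ • (z (r * s⁻¹) * ‖α r b‖)) μ :=
    (continuous_modulus_inv.smul ((transR z s).continuous.mul
      (α.strong_cont' b).norm)).integrable_of_hasCompactSupport h_supp.smul_left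
  have h_norm (r : G) : ‖check α (tensor (transR z s) b) r‖ =
      modulus r⁻¹ • (z (r * s⁻¹) * ‖α r b‖) := by
    rw [check_apply, tensor_apply, transR_apply, (α r).map_smul_of_tower, norm_smul, norm_smul,
      Real.norm_of_nonneg (modulus_pos _).le, Real.norm_of_nonneg (hz _), smul_eq_mul]
  calc ‖toWCc μ α ω (check α (tensor (transR z s) b))‖
      ≤ ∫ r, w * modulus r⁻¹ • (z (r * s⁻¹) * ‖α r b‖) ∂μ := by
        refine integral_mono (toWCc μ α ω _).integrable (h_int.const_mul w) fun r => ?_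
        change ‖check α (tensor (transR z s) b) r‖ * ω r ≤ _
        by_cases hr : z (r * s⁻¹) = 0
        · simp [h_norm, hr]
        · rw [← h_norm, mul_comm]
          exact mul_le_mul_of_nonneg_right (by simpa using hw _ hr) (norm_nonneg _)
    _ = w * ∫ r, (modulus r⁻¹ * z r) • ‖α (r * s) b‖ ∂μ := by
        rw [integral_const_mul, ← integral_modulus_inv_smul_mul_right h_supp s]
        simp only [mul_inv_cancel_right, smul_eq_mul, mul_assoc (modulus _)]

theorem Weight.iInf_iSup_nonneg {G : Type*} [Group G] [MeasurableSpace G] (ω : Weight G)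
    (𝒵 : Set (Set G)) : 0 ≤ ⨅ V : 𝒵, ⨆ r : V.1, ω r :=
  Real.iInf_nonneg fun _ => Real.iSup_nonneg fun _ => ω.nonneg' _

theorem IsCompactNhdBase.le_iInf_iSup_mul {G : Type*} [Group G] [TopologicalSpace G]
    [IsTopologicalGroup G] [LocallyCompactSpace G] [MeasurableSpace G] [BorelSpace G]
    {𝒵 : Set (Set G)} (h𝒵 : IsCompactNhdBase 𝒵) (ω : Weight G) {y B : ℝ} (hB : 0 ≤ B)
    (h : ∀ V ∈ 𝓝 (1 : G), ∀ w, (∀ r ∈ V, ω r ≤ w) → y ≤ w * B) :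
    y ≤ (⨅ V : 𝒵, ⨆ r : V.1, ω r) * B := by
  obtain ⟨V₀, hV₀, -⟩ := h𝒵.base _ univ_mem
  have : Nonempty 𝒵 := ⟨⟨V₀, hV₀⟩⟩
  obtain ⟨L, hL, h_sub⟩ := h𝒵.compact
  obtain ⟨D, hD⟩ := ω.bddOn_compact hL
  rw [Real.iInf_mul_of_nonneg hB]
  refine le_ciInf fun V => h V (h𝒵.mem_nhds V V.2) _ fun r hr => ?_
  exact le_ciSup (f := fun r : V.1 => ω r)
    ⟨D, Set.forall_mem_range.2 fun r => hD r (h_sub V V.2 r.2)⟩ ⟨r, hr⟩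

namespace AAPair

variable {X : Type*} [NormedAddCommGroup X] [NormedSpace 𝕜 X] [CompleteSpace X]
  [NormedSpace ℝ X] [IsScalarTower ℝ 𝕜 X] (μ) (P : AAPair α ω X)

theorem norm_U_π_le {V : Set G} (hV : V ∈ 𝓝 (1 : G)) {s : G} {w : ℝ}
    (hw : ∀ r ∈ V, ω (r * s) ≤ w) (a : A) (x : X) :
    ‖P.U s (P.π a x)‖ ≤ ‖P.integrated μ‖ * (w * ‖a‖) * ‖x‖ := by
  obtain ⟨𝒵, h𝒵⟩ := exists_isCompactNhdBase G
  obtain ⟨z, hz⟩ := exists_isBumpFamily μ h𝒵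
  have := h𝒵.neBot
  have h_inv : α s (α s⁻¹ a) = a := by simpa only [inv_inv] using α.inv_apply_apply s⁻¹ a
  have h_lim := hz.tendsto_integral h𝒵 (F := fun r => ‖α (r * s) (α s⁻¹ a)‖)
    ((α.strong_cont' _).comp (continuous_mul_const s)).norm
  rw [one_mul, h_inv] at h_lim
  rw [← h_inv, P.U_π, h_inv]
  refine le_of_tendsto_of_tendsto
    (P.tendsto_integrated_check_tensor μ h𝒵 hz s (α s⁻¹ a) x).norm
    (((h_lim.const_mul w).const_mul ‖P.integrated μ‖).mul_const ‖x‖) ?_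
  filter_upwards [h𝒵.eventually_subset hV] with W hWV
  refine (P.integrated μ).le_of_opNorm₂_le_of_le le_rfl ?_ le_rfl
  rw [norm_toL1]
  exact norm_toWCc_check_tensor_le (hz.nonneg _) s _ fun r hr => hw r (hWV (hz.supp _ hr))

variable {𝒵 : Set (Set G)} (h𝒵 : IsCompactNhdBase 𝒵)

include h𝒵

theorem norm_π_le : ‖P.π‖ ≤ (⨅ V : 𝒵, ⨆ r : V.1, ω r) * ‖P.integrated μ‖ := by
  have hκ := ω.iInf_iSup_nonneg 𝒵
  refine ContinuousLinearMap.opNorm_le_bound₂ _ (by positivity) fun a x => ?_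
  suffices h : ‖P.π a x‖ ≤
      (⨅ V : 𝒵, ⨆ r : V.1, ω r) * (‖P.integrated μ‖ * ‖a‖ * ‖x‖) from h.trans_eq (by ring)
  refine h𝒵.le_iInf_iSup_mul ω (by positivity) fun V hV w hw => ?_
  have h_one := P.norm_U_π_le μ hV (s := 1) (w := w) (by simpa only [mul_one] using hw) a x
  rw [P.U_one] at h_one
  exact h_one.trans_eq (by ring)

theorem norm_U_le {I : Type*} [Preorder I] [IsDirected I (· ≤ ·)] [Nonempty I] {u : I → A}
    (hu : IsBddApproxRightId u) {M : ℝ} (hM : ∀ i, ‖u i‖ ≤ M) (s : G) :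
    ‖P.U s‖ ≤ M * (⨅ V : 𝒵, ⨆ r : V.1, ω r) * ‖P.integrated μ‖ * ω s := by
  have hκ := ω.iInf_iSup_nonneg 𝒵
  have hω := ω.nonneg' s
  have hM_nonneg : 0 ≤ M := (norm_nonneg _).trans (hM (Classical.arbitrary I))
  refine ContinuousLinearMap.opNorm_le_bound _ (by positivity) fun x => ?_
  suffices h : ‖P.U s x‖ ≤
      (⨅ V : 𝒵, ⨆ r : V.1, ω r) * (‖P.integrated μ‖ * ω s * M * ‖x‖) from h.trans_eq (by ring)
  refine h𝒵.le_iInf_iSup_mul ω (by positivity) fun V hV w hw => ?_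
  have hw_nonneg : 0 ≤ w := (ω.nonneg' 1).trans (hw 1 (mem_of_mem_nhds hV))
  refine le_of_tendsto (((P.U s).continuous.tendsto _).comp
    (P.tendsto_π_of_approxRightId hu x)).norm (Eventually.of_forall fun i => ?_)
  calc ‖P.U s (P.π (u i) x)‖ ≤ ‖P.integrated μ‖ * (w * ω s * ‖u i‖) * ‖x‖ :=
        P.norm_U_π_le μ hV (fun r hr =>
          (ω.submul' r s).trans (mul_le_mul_of_nonneg_right (hw r hr) hω)) (u i) x
    _ ≤ ‖P.integrated μ‖ * (w * ω s * M) * ‖x‖ := by gcongr; exact hM i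
    _ = w * (‖P.integrated μ‖ * ω s * M * ‖x‖) := by ring

end AAPair

end Bounds

end BeurlingAnti

open BeurlingAnti in
theorem mainTheorem6_general {𝕜 G A X : Type*} [RCLike 𝕜]
    [Group G] [TopologicalSpace G] [IsTopologicalGroup G] [LocallyCompactSpace G]
    [MeasurableSpace G] [BorelSpace G] (μ : Measure G) [μ.IsHaarMeasure]
    [NonUnitalNormedRing A] [NormedSpace 𝕜 A] [IsScalarTower 𝕜 A A] [SMulCommClass 𝕜 A A]
    [CompleteSpace A] [NormedSpace ℝ A] [IsScalarTower ℝ 𝕜 A]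
    [NormedAddCommGroup X] [NormedSpace 𝕜 X] [CompleteSpace X]
    [NormedSpace ℝ X] [IsScalarTower ℝ 𝕜 X]
    (α : BddDynSystem 𝕜 G A) (ω : Weight G)
    {J : Type*} [Preorder J] [IsDirected J (· ≤ ·)] [Nonempty J]
    (v : J → A) (hv : IsBddApproxRightId v) :
    ∃ e : AAPair α ω X ≃ AntiRep μ α ω X,
      (∀ (P : AAPair α ω X) (f : C_c(G, A)) (x : X),
        (e P).T (toL1 μ α ω f) x = ∫ r, P.U r (P.π (f r) x) ∂μ) ∧
      (∀ (T : AntiRep μ α ω X) (𝒵 : Set (Set G)) (_ : IsCompactNhdBase 𝒵)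
        (z : 𝒵 → C_c(G, ℝ)) (_ : IsBumpFamily μ 𝒵 z)
        (I : Type*) [Preorder I] [IsDirected I (· ≤ ·)] [Nonempty I]
        (u : I → A) (_ : IsBddApproxRightId u),
        (∀ (a : A) (x : X), Tendsto
          (fun p : (↥𝒵)ᵒᵈ × I =>
            T.T (toL1 μ α ω (check α (tensor (z (OrderDual.ofDual p.1)) (u p.2 * a)))) x)
          atTop (𝓝 ((e.symm T).π a x))) ∧
        (∀ (s : G) (x : X), Tendsto
          (fun p : (↥𝒵)ᵒᵈ × I =>
            T.T (toL1 μ α ω (check α (tensor (transR (z (OrderDual.ofDual p.1)) s) (u p.2)))) x)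
          atTop (𝓝 ((e.symm T).U s x)))) ∧
      (∀ (P : AAPair α ω X) (C : ℝ), (∀ r, ‖P.U r‖ ≤ C * ω r) → ‖(e P).T‖ ≤ C * ‖P.π‖) ∧
      (∀ (T : AntiRep μ α ω X) (𝒵 : Set (Set G)), IsCompactNhdBase 𝒵 →
        ‖(e.symm T).π‖ ≤ (⨅ V : 𝒵, ⨆ r : V.1, ω r) * ‖T.T‖) ∧
      (∀ (T : AntiRep μ α ω X) (𝒵 : Set (Set G)), IsCompactNhdBase 𝒵 →
        ∀ (I : Type*) [Preorder I] [IsDirected I (· ≤ ·)] [Nonempty I]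
          (u : I → A), IsBddApproxRightId u →
          ∀ M : ℝ, (∀ i, ‖u i‖ ≤ M) → ∀ s : G,
            ‖(e.symm T).U s‖ ≤ M * (⨅ V : 𝒵, ⨆ r : V.1, ω r) * ‖T.T‖ * ω s) := by
  let e : AAPair α ω X ≃ AntiRep μ α ω X := Equiv.ofBijective (fun P => P.toAntiRep μ)
    ⟨AAPair.toAntiRep_injective μ hv, fun T => T.exists_toAntiRep_eq hv⟩
  refine ⟨e, fun P => P.integrated_toL1_apply μ, fun T 𝒵 h𝒵 z hz I _ _ _ u hu => ?_,
    fun P C => P.norm_integrated_le μ, fun T 𝒵 h𝒵 => ?_, fun T 𝒵 h𝒵 I _ _ _ u hu M hM s => ?_⟩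
  all_goals
    obtain ⟨P, rfl⟩ := e.surjective T
    rw [e.symm_apply_apply]
  · exact ⟨P.tendsto_integrated_π μ h𝒵 hz hu, P.tendsto_integrated_U μ h𝒵 hz hu⟩
  · exact P.norm_π_le μ h𝒵
  · exact P.norm_U_le μ h𝒵 hu hM s

open BeurlingAnti in
theorem mainTheorem6 {𝕜 G A X : Type*} [RCLike 𝕜]
    [Group G] [TopologicalSpace G] [IsTopologicalGroup G] [LocallyCompactSpace G] [T2Space G]
    [MeasurableSpace G] [BorelSpace G] (μ : Measure G) [μ.IsHaarMeasure] [μ.Regular]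
    [NonUnitalNormedRing A] [NormedSpace 𝕜 A] [IsScalarTower 𝕜 A A] [SMulCommClass 𝕜 A A]
    [CompleteSpace A] [NormedSpace ℝ A] [IsScalarTower ℝ 𝕜 A]
    [NormedAddCommGroup X] [NormedSpace 𝕜 X] [CompleteSpace X]
    [NormedSpace ℝ X] [IsScalarTower ℝ 𝕜 X]
    (α : BddDynSystem 𝕜 G A) (ω : Weight G)
    {J : Type*} [Preorder J] [IsDirected J (· ≤ ·)] [Nonempty J]
    (v : J → A) (hv : IsBddApproxId v) :
    ∃ e : AAPair α ω X ≃ AntiRep μ α ω X,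
      (∀ (P : AAPair α ω X) (f : C_c(G, A)) (x : X),
        (e P).T (toL1 μ α ω f) x = ∫ r, P.U r (P.π (f r) x) ∂μ) ∧
      (∀ (T : AntiRep μ α ω X) (𝒵 : Set (Set G)) (_ : IsCompactNhdBase 𝒵)
        (z : 𝒵 → C_c(G, ℝ)) (_ : IsBumpFamily μ 𝒵 z)
        (I : Type*) [Preorder I] [IsDirected I (· ≤ ·)] [Nonempty I]
        (u : I → A) (_ : IsBddApproxRightId u),
        (∀ (a : A) (x : X), Tendsto
          (fun p : (↥𝒵)ᵒᵈ × I =>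
            T.T (toL1 μ α ω (check α (tensor (z (OrderDual.ofDual p.1)) (u p.2 * a)))) x)
          atTop (𝓝 ((e.symm T).π a x))) ∧
        (∀ (s : G) (x : X), Tendsto
          (fun p : (↥𝒵)ᵒᵈ × I =>
            T.T (toL1 μ α ω (check α (tensor (transR (z (OrderDual.ofDual p.1)) s) (u p.2)))) x)
          atTop (𝓝 ((e.symm T).U s x)))) ∧
      (∀ (P : AAPair α ω X) (C : ℝ), (∀ r, ‖P.U r‖ ≤ C * ω r) → ‖(e P).T‖ ≤ C * ‖P.π‖) ∧
      (∀ (T : AntiRep μ α ω X) (𝒵 : Set (Set G)), IsCompactNhdBase 𝒵 →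
        ‖(e.symm T).π‖ ≤ (⨅ V : 𝒵, ⨆ r : V.1, ω r) * ‖T.T‖) ∧
      (∀ (T : AntiRep μ α ω X) (𝒵 : Set (Set G)), IsCompactNhdBase 𝒵 →
        ∀ (I : Type*) [Preorder I] [IsDirected I (· ≤ ·)] [Nonempty I]
          (u : I → A), IsBddApproxRightId u →
          ∀ M : ℝ, (∀ i, ‖u i‖ ≤ M) → ∀ s : G,
            ‖(e.symm T).U s‖ ≤ M * (⨅ V : 𝒵, ⨆ r : V.1, ω r) * ‖T.T‖ * ω s) :=
  mainTheorem6_general μ α ω v hv.toIsBddApproxRightId
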